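/- Let $f,D,g:[0,1]\to\mathbb R$ satisfy: $f\in C^1[0,1]$, $f(0)=0$; $D\in C^1[0,1]$, $D>0$ in $(0,1)$, $D(0)=0$; $g\in C^0[0,1]$, $g>0$ in $(0,1)$, $g(0)=g(1)=0$; and $\limsup_{s\to0^+}D(s)g(s)/s<+\infty$. Write $h=\dot f$, and consider the equation $$\rho_t+f(\rho)_x=(D(\rho)\rho_x)_x+g(\rho).\tag{E}$$ *Definitions.* A *wavefront* of (E) from $1$ to $0$ with speed $c\in\mathbb R$ is a solution $\rho(t,x)=\varphi(x-ct)$ whose profile $\varphi:\mathbb R\to[0,1]$ is locally absolutely continuous, monotone and non-constant, with $D(\varphi)\varphi'\in L^1_{\rm loc}(\mathbb R)$, $\varphi(-\infty)=1$, $\varphi(+\infty)=0$, and $$\int_{\mathbb R}\bigl(D(\varphi)\varphi'-f(\varphi)+c\varphi\bigr)\psi'-g(\varphi)\psi\,d\xi=0\qquad\text{for all }\psi\in C_0^\infty(\mathbb R).$$ The profile $\varphi$ is *classical on* an open set $J$ if it is differentiable in $J$, $D(\varphi)\varphi'$ is locally absolutely continuous in $J$, and $(D(\varphi)\varphi')'+(c-h(\varphi))\varphi'+g(\varphi)=0$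 a.e. in $J$. It is *classical at $0$* if it is classical on $\{\xi:\varphi(\xi)\neq1\}$. It is *sharp at $0$* if there is $\xi_0\in\mathbb R$ with $\varphi(\xi_0)=0$ such that $\varphi$ is not differentiable at $\xi_0$ and is classical on $\{\xi:\varphi(\xi)\ne1\}\setminus\{\xi_0\}$. **Theorem.** There exists $c^*\in\mathbb R$ satisfying $$\sup_{s\in(0,1]}\frac{f(s)}{s}\le c^*\le\sup_{s\in(0,1]}\frac{f(s)}{s}+2\sqrt{\sup_{s\in(0,1]}\frac1s\int_0^s\frac{D(\sigma)g(\sigma)}{\sigma}\,d\sigma}$$ such that (E) admits a wavefront from $1$ to $0$ with speed $c$ if and only if $c\ge c^*$; for each such $c$ its profile is unique up to shifts $\xi\mapsto\xi+\tau$. Moreover, the profile $\varphi$ of any such wavefront, with speed $c$, satisfies $\varphi'(\xi)<0$ whenever $0<\varphi(\xi)<1$, and (i) if $c>c^*$, then $\varphi$ is classical at $0$; (ii) if $c=c^*$ and $c^*>h(0)$, then $\varphi$ is sharp at $0$, and if $\varphi$ reaches $0$ at $\xi_0\in\mathbb R$ (that is, $\varphi(\xi_0)=0$ and $\varphi>0$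 on $(-\infty,\xi_0)$), then $$\lim_{\xi\to\xi_0^-}\varphi'(\xi)=\begin{cases}\dfrac{h(0)-c^*}{\dot D(0)}<0&\text{if }\dot D(0)>0,\\[2mm]-\infty&\text{if }\dot D(0)=0.\end{cases}$$ -/

import Mathlib

open Set Filter Topology MeasureTheory
open scoped ContDiff

/-- `u` is locally absolutely continuous on `J`: absolutely continuous on every compact
interval contained in `J`. -/
def LocallyAC (u : ℝ → ℝ) (J : Set ℝ) : Prop :=
  ∀ a b : ℝ, uIcc a b ⊆ J → AbsolutelyContinuousOnInterval u a b

/-- `φ`, defined on the open interval `I`, is the profile of a traveling-wave solution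
`ρ(t,x) = φ(x - c t)`, with speed `c`, of `ρ_t + f(ρ)_x = (D(ρ) ρ_x)_x + g(ρ)`.
The functions `f, D, g` are only used on `[0,1]`. Local absolute continuity of `φ` says that the
a.e. derivative `φ'` is the weak derivative of `φ`. -/
structure IsTravelingWave (f D g : ℝ → ℝ) (I : Set ℝ) (c : ℝ) (φ : ℝ → ℝ) : Prop where
  isOpen : IsOpen I
  ordConnected : I.OrdConnected
  continuousOn : ContinuousOn φ I
  mem_Icc : ∀ ξ ∈ I, φ ξ ∈ Icc (0 : ℝ) 1
  locallyAC : LocallyAC φ I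
  ae_differentiableAt : ∀ᵐ ξ ∂(volume.restrict I), DifferentiableAt ℝ φ ξ
  locallyIntegrableOn : LocallyIntegrableOn (fun ξ => D (φ ξ) * deriv φ ξ) I
  weak_eq : ∀ ψ : ℝ → ℝ, ContDiff ℝ ∞ ψ → HasCompactSupport ψ → tsupport ψ ⊆ I →
    ∫ ξ in I, ((D (φ ξ) * deriv φ ξ - f (φ ξ) + c * φ ξ) * deriv ψ ξ - g (φ ξ) * ψ ξ) = 0

/-- `φ` is classical on the open set `J`: it is differentiable there, `D(φ) φ'` is (locally)
absolutely continuous, and `(D(φ) φ')' + (c - h(φ)) φ' + g(φ) = 0` a.e. in `J`, where `h` is the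
derivative of `f` on `[0,1]`. -/
structure IsClassicalOn (f D g : ℝ → ℝ) (c : ℝ) (φ : ℝ → ℝ) (J : Set ℝ) : Prop where
  differentiableAt : ∀ ξ ∈ J, DifferentiableAt ℝ φ ξ
  locallyAC : LocallyAC (fun ξ => D (φ ξ) * deriv φ ξ) J
  ode : ∀ᵐ ξ ∂(volume.restrict J),
    deriv (fun η => D (φ η) * deriv φ η) ξ
      + (c - derivWithin f (Icc 0 1) (φ ξ)) * deriv φ ξ + g (φ ξ) = 0

/-- `φ : I → [0,1]` is classical at the equilibrium `ℓ ∈ {0,1}`: it is classical on the part of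
`I` where it is away from the other equilibrium `1 - ℓ`. -/
def IsClassicalAt (f D g : ℝ → ℝ) (I : Set ℝ) (c : ℝ) (φ : ℝ → ℝ) (ℓ : ℝ) : Prop :=
  IsClassicalOn f D g c φ {ξ ∈ I | φ ξ ≠ 1 - ℓ}

/-- `φ : I → [0,1]` is sharp at the equilibrium `ℓ ∈ {0,1}`: it takes the value `ℓ` at some
`ξ_ℓ ∈ I` where it is not differentiable, while, away from the other equilibrium `1 - ℓ`, it is
classical except at `ξ_ℓ`. -/
def IsSharpAt (f D g : ℝ → ℝ) (I : Set ℝ) (c : ℝ) (φ : ℝ → ℝ) (ℓ : ℝ) : Prop :=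
  ∃ ξℓ ∈ I, φ ξℓ = ℓ ∧ ¬ DifferentiableAt ℝ φ ξℓ ∧
    IsClassicalOn f D g c φ ({ξ ∈ I | φ ξ ≠ 1 - ℓ} \ {ξℓ})

/-- `φ` is the profile of a wavefront with speed `c` from `1` (at `-∞`) to `0` (at `+∞`): a global
traveling wave with monotone, non-constant profile having these limits. -/
structure IsWavefront (f D g : ℝ → ℝ) (c : ℝ) (φ : ℝ → ℝ) : Prop where
  travelingWave : IsTravelingWave f D g univ c φ
  monotonic : Monotone φ ∨ Antitone φ
  nonconstant : ∃ ξ₁ ξ₂ : ℝ, φ ξ₁ ≠ φ ξ₂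
  tendsto_atBot : Tendsto φ atBot (𝓝 1)
  tendsto_atTop : Tendsto φ atTop (𝓝 0)

/-- `sup_{s ∈ (0,1]} f(s) / s`. -/
noncomputable def supConvection (f : ℝ → ℝ) : ℝ :=
  sSup ((fun s => f s / s) '' Ioc (0 : ℝ) 1)

/-- `sup_{s ∈ (0,1]} (1/s) ∫_0^s D(σ) g(σ) / σ dσ`. -/
noncomputable def supMeanReaction (D g : ℝ → ℝ) : ℝ :=
  sSup ((fun s => (1 / s) * ∫ σ in (0 : ℝ)..s, D σ * g σ / σ) '' Ioc (0 : ℝ) 1)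

/-!
Along a profile `φ` the equation is of first order in the variable `s = φ`. If `V` denotes the
continuous representative of the flux `D(φ) φ'`, then `y(φ) = -V` satisfies on `(0,1)`
`y' = c - h - D g / y`, `y > 0`, `y(1) = 0`, with `h = f'`
(`IsReactionDiffusionData.phase_comp_eq_neg_flux`). This singular terminal-value problem has exactly
one solution for each real `c` (`exists_isTerminalSolution` constructs it, by truncating the
singular term; uniqueness and monotone, Lipschitz dependence on `c` come from the comparison
principle `IsTerminalSolution.le_of_supersolution`). A wavefront of speed `c` exists if and only if
the solution also vanishes at `0`, which is equivalent to `y(s) ≤ c s - f(s)`; such `c` are called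
admissible.

* Since `y > 0`, an admissible `c` is at least `sup f(s) / s`. The explicit supersolution
  `c s - f(s) - M^{-1/2} ∫₀ˢ D g / σ` shows that `sup f(s) / s + 2 √M` is admissible, and the
  dependence on `c` shows that the admissible speeds form a closed half-line `[c*, ∞)`
  (`IsReactionDiffusionData.exists_criticalSpeed`).
* From a wavefront to `y`: the du Bois-Reymond lemma turns the weak equation into the
  differentiability of `V - f(φ) + c φ`, whose derivative is `-g(φ)`. Moreover `V ≤ 0` cannot stay
  away from `0` on long intervals, because `φ` is bounded. At `-∞` this identifies `-V` with `y(φ)`,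
  in particular `φ' < 0` where `0 < φ < 1`; at `+∞` it makes `c` admissible.
* From `y` to a wavefront: `φ' = -y(φ) / D(φ)` is solved by separation of variables, with the travel
  time `T(s) = ∫ D / y`. The same function yields uniqueness up to shifts.
* Regularity at `0` is decided by the limit of `y / D`. If `c > c*`, then `y / D → 0`, so that `φ`
  is differentiable where it reaches `0`
  (`IsReactionDiffusionData.tendsto_phaseSolution_div_diffusion`). If `c = c* > h(0)`, then
  `y / s → c* - h(0) > 0`, since otherwise a line of smaller slope would be a supersolution for
  speeds below `c*` (`IsReactionDiffusionData.tendsto_phaseSolution_div_critical`). As `D = O(s)`,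
  the profile then reaches `0` at a finite point with slope bounded away from zero.
-/

/-! ### Comparison and the truncated first-order problem -/

/-- A function that is nondecreasing wherever it is positive keeps its positive initial value
as a lower bound. -/
lemma le_of_deriv_nonneg_of_pos {d : ℝ → ℝ} {a b : ℝ} (hab : a ≤ b)
    (hc : ContinuousOn d (Icc a b))
    (hd : ∀ s ∈ Ioo a b, 0 < d s → ∃ d', HasDerivAt d d' s ∧ 0 ≤ d') (ha : 0 < d a) :
    d a ≤ d b := by
  by_contra! hlt
  -- the last time `t` at which `d` is at least `d a`
  set S := {t ∈ Icc a b | d a ≤ d t} with hS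
  have hcl : IsClosed S :=
    hc.preimage_isClosed_of_isClosed isClosed_Icc (isClosed_Ici (a := d a))
  have hcomp : IsCompact S := isCompact_Icc.of_isClosed_subset hcl (fun x hx => hx.1)
  have hne : S.Nonempty := ⟨a, ⟨le_rfl, hab⟩, le_rfl⟩
  obtain ⟨htI, hdt⟩ := hcomp.sSup_mem hne
  set t := sSup S
  have htb : t < b := lt_of_le_of_ne htI.2 (fun h => by rw [h] at hdt; linarith)
  have hpos : ∀ᶠ x in 𝓝[Icc a b] t, 0 < d x :=
    (hc t htI).eventually (lt_mem_nhds (lt_of_lt_of_le ha hdt))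
  obtain ⟨η, hη, hball⟩ := Metric.mem_nhdsWithin_iff.1 hpos
  set u := min b (t + η / 2) with hu
  have htu : t < u := lt_min htb (by linarith)
  have hub : u ≤ b := min_le_left _ _
  have hmono : MonotoneOn d (Icc t u) := by
    have hder : ∀ x ∈ Ioo t u, ∃ d', HasDerivAt d d' x ∧ 0 ≤ d' := by
      intro x hx
      refine hd x ⟨htI.1.trans_lt hx.1, hx.2.trans_le hub⟩ (hball ⟨?_, ?_⟩)
      · rw [Metric.mem_ball, Real.dist_eq, abs_of_pos (by linarith [hx.1])]
        have := hx.2.trans_le (min_le_right _ _)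
        linarith
      · exact ⟨htI.1.trans hx.1.le, hx.2.le.trans hub⟩
    refine monotoneOn_of_deriv_nonneg (convex_Icc _ _)
      (hc.mono (Icc_subset_Icc htI.1 hub)) ?_ ?_
    · rw [interior_Icc]
      intro x hx
      obtain ⟨d', h1, -⟩ := hder x hx
      exact h1.differentiableAt.differentiableWithinAt
    · rw [interior_Icc]
      intro x hx
      obtain ⟨d', h1, h2⟩ := hder x hx
      rwa [h1.deriv]
  have huS : u ∈ S := ⟨⟨htI.1.trans htu.le, hub⟩,
    hdt.trans (hmono ⟨le_rfl, htu.le⟩ ⟨htu.le, le_rfl⟩ htu.le)⟩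
  exact absurd (le_csSup hcomp.bddAbove huS) (not_le.2 htu)

/-- `y` solves the singular first-order equation `y' = p - q / y` on `(0,1)` with `y(1) = 0` and
`y > 0` on `(0,1)`. No condition is imposed at `0`. -/
structure IsTerminalSolution (p q y : ℝ → ℝ) : Prop where
  continuousOn : ContinuousOn y (Ioc 0 1)
  terminal : y 1 = 0
  pos : ∀ s ∈ Ioo (0 : ℝ) 1, 0 < y s
  hasDerivAt : ∀ s ∈ Ioo (0 : ℝ) 1, HasDerivAt y (p s - q s / y s) s

/-- `Y` solves the regularized equation `Y' = p - q / max Y ε` on `(0,1)` with `Y(1) = 0`. -/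
structure IsTruncatedSolution (p q : ℝ → ℝ) (ε : ℝ) (Y : ℝ → ℝ) : Prop where
  continuousOn : ContinuousOn Y (Icc 0 1)
  terminal : Y 1 = 0
  hasDerivAt : ∀ s ∈ Ioo (0 : ℝ) 1, HasDerivAt Y (p s - q s / max (Y s) ε) s

/-- The truncation makes the equation globally Lipschitz and bounded, so that Picard–Lindelöf
gives a solution on all of `[0,1]`. -/
lemma exists_truncated_solution {p q : ℝ → ℝ} (hp : ContinuousOn p (Icc 0 1))
    (hq : ContinuousOn q (Icc 0 1)) {ε : ℝ} (hε : 0 < ε) :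
    ∃ Y : ℝ → ℝ, IsTruncatedSolution p q ε Y := by
  obtain ⟨P, hP⟩ := isCompact_Icc.exists_bound_of_continuousOn hp
  obtain ⟨Q, hQ⟩ := isCompact_Icc.exists_bound_of_continuousOn hq
  have hP0 : 0 ≤ P := (norm_nonneg _).trans (hP 0 (by simp))
  have hQ0 : 0 ≤ Q := (norm_nonneg _).trans (hQ 0 (by simp))
  have hmax : ∀ x : ℝ, 0 < max x ε := fun x => lt_max_of_lt_right hε
  set L : NNReal := ⟨P + Q / ε, by positivity⟩ with hL
  set K : NNReal := ⟨Q / ε ^ 2, by positivity⟩ with hK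
  have hPL : IsPicardLindelof (fun s x => p s - q s / max x ε)
      (⟨1, by simp⟩ : Icc (0 : ℝ) 1) 0 L 0 L K := by
    refine ⟨?_, ?_, ?_, ?_⟩
    · intro t ht
      refine LipschitzOnWith.of_dist_le_mul fun x _ y _ => ?_
      have h1 : p t - q t / max x ε - (p t - q t / max y ε)
          = q t * (max x ε - max y ε) / (max x ε * max y ε) := by
        have := (hmax x).ne'; have := (hmax y).ne'
        field_simp; ring
      rw [Real.dist_eq, h1, abs_div, abs_mul, abs_of_pos (mul_pos (hmax x) (hmax y)), Real.dist_eq]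
      have h2 : |max x ε - max y ε| ≤ |x - y| := by
        simpa using abs_max_sub_max_le_abs x y ε
      have h3 : ε ^ 2 ≤ max x ε * max y ε := by
        rw [sq]; exact mul_le_mul (le_max_right _ _) (le_max_right _ _) hε.le (hmax x).le
      have h4 := hQ t ht
      rw [Real.norm_eq_abs] at h4
      change _ ≤ Q / ε ^ 2 * |x - y|
      rw [div_mul_eq_mul_div]
      gcongr
    · intro x _
      exact hp.sub (hq.div_const _)
    · intro t ht x _
      change _ ≤ P + Q / ε
      refine (norm_sub_le _ _).trans (add_le_add (hP t ht) ?_)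
      rw [norm_div, Real.norm_of_nonneg (hmax x).le]
      gcongr
      · exact hQ t ht
      · exact le_max_right _ _
    · simp
  obtain ⟨Y, hY1, hY⟩ := hPL.exists_eq_forall_mem_Icc_hasDerivWithinAt₀
  refine ⟨Y, fun s hs => (hY s hs).continuousWithinAt, hY1, fun s hs => ?_⟩
  exact (hY s ⟨hs.1.le, hs.2.le⟩).hasDerivAt (Icc_mem_nhds hs.1 hs.2)

/-! ### Bounds on truncated solutions -/

namespace IsTruncatedSolution

variable {p q : ℝ → ℝ} {ε ε' P Q : ℝ} {Y Y' : ℝ → ℝ}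

lemma antitone_truncation (hY : IsTruncatedSolution p q ε Y) (hY' : IsTruncatedSolution p q ε' Y')
    (hq : ∀ s ∈ Ioo (0 : ℝ) 1, 0 < q s) (hε : 0 < ε) (hεε' : ε ≤ ε') {s : ℝ}
    (hs : s ∈ Icc (0 : ℝ) 1) : Y' s ≤ Y s := by
  by_contra! h
  have := le_of_deriv_nonneg_of_pos (d := fun t => Y' t - Y t) hs.2
    ((hY'.continuousOn.sub hY.continuousOn).mono (Icc_subset_Icc hs.1 le_rfl)) ?_ (by simpa using h)
  · simp only [hY.terminal, hY'.terminal] at this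
    linarith
  · intro t ht hpos
    have ht' : t ∈ Ioo (0 : ℝ) 1 := ⟨hs.1.trans_lt ht.1, ht.2⟩
    refine ⟨_, (hY'.hasDerivAt t ht').sub (hY.hasDerivAt t ht'), ?_⟩
    have h1 : q t / max (Y' t) ε' ≤ q t / max (Y t) ε := by
      refine div_le_div_of_nonneg_left (hq t ht').le (lt_max_of_lt_right hε) ?_
      exact max_le_max (by linarith) hεε'
    linarith

lemma le_add_mul (hY : IsTruncatedSolution p q ε Y) (hP : ∀ s ∈ Icc (0 : ℝ) 1, ‖p s‖ ≤ P)
    (hQ : ∀ s ∈ Icc (0 : ℝ) 1, ‖q s‖ ≤ Q) {η : ℝ} (hη : 0 < η) {s : ℝ}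
    (hs : s ∈ Icc (0 : ℝ) 1) : Y s ≤ η + (P + Q / η) * (1 - s) := by
  by_contra! h
  have := le_of_deriv_nonneg_of_pos (d := fun t => Y t - (η + (P + Q / η) * (1 - t))) hs.2
    ((hY.continuousOn.sub (by fun_prop)).mono (Icc_subset_Icc hs.1 le_rfl)) ?_ (by simpa using h)
  · simp only [hY.terminal] at this
    linarith
  · intro t ht hpos
    have ht' : t ∈ Ioo (0 : ℝ) 1 := ⟨hs.1.trans_lt ht.1, ht.2⟩
    have htI : t ∈ Icc (0 : ℝ) 1 := ⟨ht'.1.le, ht'.2.le⟩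
    have hlin : HasDerivAt (fun t => η + (P + Q / η) * (1 - t)) (-(P + Q / η)) t := by
      have := (((hasDerivAt_id t).const_sub 1).const_mul (P + Q / η)).const_add η
      simpa using this
    refine ⟨_, (hY.hasDerivAt t ht').sub hlin, ?_⟩
    have hP0 : 0 ≤ P := (norm_nonneg _).trans (hP t htI)
    have hQ0 : 0 ≤ Q := (norm_nonneg _).trans (hQ t htI)
    have hYη : η ≤ max (Y t) ε := by
      refine le_trans ?_ (le_max_left _ _)
      have : 0 ≤ (P + Q / η) * (1 - t) :=
        mul_nonneg (by positivity) (by linarith [ht'.2])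
      linarith
    have h1 : q t / max (Y t) ε ≤ Q / η := by
      have hqQ : q t ≤ Q := (le_abs_self _).trans (hQ t htI)
      calc q t / max (Y t) ε ≤ Q / max (Y t) ε := by
            gcongr
            exact hη.le.trans hYη
        _ ≤ Q / η := by gcongr
    have h2 := neg_le_of_abs_le (hP t htI)
    linarith

lemma neg_mul_le (hY : IsTruncatedSolution p q ε Y) (hP : ∀ s ∈ Icc (0 : ℝ) 1, ‖p s‖ ≤ P)
    (hq : ∀ s ∈ Ioo (0 : ℝ) 1, 0 < q s) (hε : 0 < ε) {s : ℝ}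
    (hs : s ∈ Icc (0 : ℝ) 1) : -P * (1 - s) ≤ Y s := by
  by_contra! h
  have := le_of_deriv_nonneg_of_pos (d := fun t => -P * (1 - t) - Y t) hs.2
    ((ContinuousOn.sub (by fun_prop) hY.continuousOn).mono (Icc_subset_Icc hs.1 le_rfl)) ?_
    (by simpa using h)
  · simp only [hY.terminal] at this
    linarith
  · intro t ht hpos
    have ht' : t ∈ Ioo (0 : ℝ) 1 := ⟨hs.1.trans_lt ht.1, ht.2⟩
    have htI : t ∈ Icc (0 : ℝ) 1 := ⟨ht'.1.le, ht'.2.le⟩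
    have hlin : HasDerivAt (fun t => -P * (1 - t)) P t := by
      have := (((hasDerivAt_id t).const_sub 1).const_mul (-P))
      simpa using this
    refine ⟨_, hlin.sub (hY.hasDerivAt t ht'), ?_⟩
    have h1 : 0 ≤ q t / max (Y t) ε :=
      div_nonneg (hq t ht').le (hε.le.trans (le_max_right _ _))
    have h2 := le_of_abs_le (hP t htI)
    linarith

/-- On a compact subinterval of `(0,1)` the truncation is inactive once `ε` is small: below the
level `ε` the solution would decrease at a rate `≈ q / ε`, contradicting the bound from below. -/
lemma exists_le_of_small (hpc : ContinuousOn p (Icc 0 1)) (hqc : ContinuousOn q (Icc 0 1))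
    (hq : ∀ s ∈ Ioo (0 : ℝ) 1, 0 < q s) {a b : ℝ} (ha : 0 < a) (hab : a ≤ b) (hb : b < 1) :
    ∃ ε₀ > 0, ∀ ε ∈ Ioc 0 ε₀, ∀ Y, IsTruncatedSolution p q ε Y → ∀ s ∈ Icc a b, ε ≤ Y s := by
  obtain ⟨P, hP⟩ := isCompact_Icc.exists_bound_of_continuousOn hpc
  have hP0 : 0 ≤ P := (norm_nonneg _).trans (hP 0 (by simp))
  set b' := (b + 1) / 2 with hb'
  obtain ⟨x, hx, hxm⟩ := (isCompact_Icc (a := a) (b := b')).exists_isMinOn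
    ⟨a, le_rfl, by linarith⟩ (hqc.mono (Icc_subset_Icc ha.le (by linarith)))
  set m := q x with hm
  have hm0 : 0 < m := hq x ⟨ha.trans_le hx.1, by linarith [hx.2]⟩
  -- at the rate `R` the solution would drop below its lower bound `-P` before reaching `b'`
  set R := (1 + P) / (b' - b) with hR
  have hbb : 0 < b' - b := by linarith
  have hR0 : 0 < R := by positivity
  refine ⟨min 1 (m / (R + P)), by positivity, fun ε hε Y hY s hs => ?_⟩
  by_contra! h
  have hε1 : ε ≤ 1 := hε.2.trans (min_le_left _ _)
  have hεm : ε ≤ m / (R + P) := hε.2.trans (min_le_right _ _)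
  have hsb : s ≤ b' := by linarith [hs.2]
  have := le_of_deriv_nonneg_of_pos (d := fun t => ε - Y t - R * (t - s)) hsb
    (ContinuousOn.sub (continuousOn_const.sub (hY.continuousOn.mono
      (Icc_subset_Icc (ha.le.trans hs.1) (by linarith)))) (by fun_prop)) ?_ (by simpa using h)
  · have h1 := hY.neg_mul_le hP hq hε.1 (s := b') ⟨by linarith, by linarith⟩
    have h2 : P * (1 - b') ≤ P * 1 := by gcongr; linarith
    have h3 : 1 + P ≤ R * (b' - s) := by
      calc 1 + P = R * (b' - b) := by rw [hR]; field_simp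
        _ ≤ _ := by gcongr; exact hs.2
    simp only [sub_self, mul_zero, sub_zero] at this
    linarith
  · intro t ht hpos
    have ht' : t ∈ Ioo (0 : ℝ) 1 := ⟨by linarith [hs.1, ht.1], by linarith [ht.2]⟩
    have hlin : HasDerivAt (fun t => R * (t - s)) R t := by
      simpa using (((hasDerivAt_id t).sub_const s).const_mul R)
    refine ⟨_, ((hY.hasDerivAt t ht').const_sub ε).sub hlin, ?_⟩
    have hYε : max (Y t) ε = ε := by
      refine max_eq_right ?_
      have : 0 ≤ R * (t - s) := mul_nonneg hR0.le (by linarith [ht.1])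
      linarith
    rw [hYε]
    have h1 : R + P ≤ q t / ε := by
      rw [le_div_iff₀ hε.1]
      calc (R + P) * ε ≤ (R + P) * (m / (R + P)) := by gcongr
        _ = m := by field_simp
        _ ≤ q t := hxm ⟨hs.1.trans ht.1.le, ht.2.le⟩
    have h2 := le_of_abs_le (hP t ⟨ht'.1.le, ht'.2.le⟩)
    linarith

end IsTruncatedSolution

/-! ### The singular terminal-value problem -/

/-- The singular problem `y' = p - q / y`, `y(1) = 0`, `y > 0` is solvable: the solution is the
increasing limit of the truncated ones as the truncation level tends to `0`. -/
theorem exists_isTerminalSolution {p q : ℝ → ℝ} (hp : ContinuousOn p (Icc 0 1))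
    (hqc : ContinuousOn q (Icc 0 1)) (hq : ∀ s ∈ Ioo (0 : ℝ) 1, 0 < q s) :
    ∃ y, IsTerminalSolution p q y := by
  obtain ⟨P, hP⟩ := isCompact_Icc.exists_bound_of_continuousOn hp
  obtain ⟨Q, hQ⟩ := isCompact_Icc.exists_bound_of_continuousOn hqc
  have hP0 : 0 ≤ P := (norm_nonneg _).trans (hP 0 (by simp))
  have hQ0 : 0 ≤ Q := (norm_nonneg _).trans (hQ 0 (by simp))
  set e : ℕ → ℝ := fun n => 1 / ((n : ℝ) + 1) with he
  have he0 : ∀ n, 0 < e n := fun n => by positivity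
  have hanti : Antitone e := fun m n h => one_div_le_one_div_of_le (by positivity) (by gcongr)
  have helim : Tendsto e atTop (𝓝 0) := tendsto_one_div_add_atTop_nhds_zero_nat
  choose Y hY using fun n => exists_truncated_solution hp hqc (he0 n)
  have hmono : ∀ s ∈ Icc (0 : ℝ) 1, Monotone fun n => Y n s := fun s hs m n h =>
    (hY n).antitone_truncation (hY m) hq (he0 n) (hanti h) hs
  have hub : ∀ η > 0, ∀ s ∈ Icc (0 : ℝ) 1, ∀ n, Y n s ≤ η + (P + Q / η) * (1 - s) :=
    fun η hη s hs n => (hY n).le_add_mul hP hQ hη hs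
  set y : ℝ → ℝ := fun s => ⨆ n, Y n s with hy
  have hlim : ∀ s ∈ Icc (0 : ℝ) 1, Tendsto (fun n => Y n s) atTop (𝓝 (y s)) := fun s hs =>
    tendsto_atTop_ciSup (hmono s hs) ⟨_, by rintro _ ⟨n, rfl⟩; exact hub 1 one_pos s hs n⟩
  have hyub : ∀ η > 0, ∀ s ∈ Icc (0 : ℝ) 1, y s ≤ η + (P + Q / η) * (1 - s) :=
    fun η hη s hs => ciSup_le fun n => hub η hη s hs n
  have hy1 : y 1 = 0 := by simp [hy, (hY _).terminal]
  -- the lower bound which is uniform in the truncation level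
  have hlow : ∀ a b : ℝ, 0 < a → a ≤ b → b < 1 → ∃ μ > 0, ∃ N, ∀ n ≥ N, ∀ s ∈ Icc a b,
      μ ≤ Y n s ∧ e n ≤ μ := by
    intro a b ha hab hb
    obtain ⟨ε₀, hε₀, h⟩ := IsTruncatedSolution.exists_le_of_small hp hqc hq ha hab hb
    obtain ⟨N, hN⟩ := (helim.eventually (gt_mem_nhds hε₀)).exists
    refine ⟨e N, he0 N, N, fun n hn s hs => ⟨?_, hanti hn⟩⟩
    exact (h (e N) ⟨he0 N, hN.le⟩ (Y N) (hY N) s hs).trans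
      (hmono s ⟨ha.le.trans hs.1, hs.2.trans hb.le⟩ hn)
  have hpos : ∀ s ∈ Ioo (0 : ℝ) 1, 0 < y s := by
    intro s hs
    obtain ⟨μ, hμ, N, h⟩ := hlow s s hs.1 le_rfl hs.2
    exact hμ.trans_le ((h N le_rfl s ⟨le_rfl, le_rfl⟩).1.trans
      ((hmono s ⟨hs.1.le, hs.2.le⟩).ge_of_tendsto (hlim s ⟨hs.1.le, hs.2.le⟩) N))
  have hcont : ContinuousOn y (Ioo 0 1) := by
    intro s hs
    set a := s / 2
    set b := (s + 1) / 2
    have ha : 0 < a := half_pos hs.1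
    have hb : b < 1 := by simp only [b]; linarith [hs.2]
    have has : a < s := half_lt_self hs.1
    have hsb : s < b := by simp only [b]; linarith [hs.2]
    obtain ⟨μ, hμ, N, h⟩ := hlow a b ha (has.trans hsb).le hb
    have hLip : LipschitzOnWith ⟨P + Q / μ, by positivity⟩ y (Icc a b) := by
      refine LipschitzOnWith.of_dist_le_mul fun u hu v hv => ?_
      have hu' : u ∈ Icc (0 : ℝ) 1 := ⟨ha.le.trans hu.1, hu.2.trans hb.le⟩
      have hv' : v ∈ Icc (0 : ℝ) 1 := ⟨ha.le.trans hv.1, hv.2.trans hb.le⟩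
      refine le_of_tendsto ((hlim u hu').dist (hlim v hv')) ?_
      filter_upwards [eventually_ge_atTop N] with n hn
      rw [dist_comm (Y n u), dist_comm u]
      refine (convex_Icc a b).norm_image_sub_le_of_norm_hasDerivWithin_le (f := Y n)
        (fun t ht => ((hY n).hasDerivAt t ⟨ha.trans_le ht.1, ht.2.trans_lt hb⟩).hasDerivWithinAt)
        (fun t ht => ?_) hu hv
      have ht' : t ∈ Icc (0 : ℝ) 1 := ⟨ha.le.trans ht.1, ht.2.trans hb.le⟩
      refine (norm_sub_le _ _).trans (add_le_add (hP t ht') ?_)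
      have hmx : μ ≤ max (Y n t) (e n) := (h n hn t ht).1.trans (le_max_left _ _)
      rw [norm_div, Real.norm_of_nonneg (hμ.le.trans hmx)]
      gcongr
      exact hQ t ht'
    exact (hLip.continuousOn.continuousAt (Icc_mem_nhds has hsb)).continuousWithinAt
  refine ⟨y, ?_, hy1, hpos, ?_⟩
  · intro s hs
    rcases hs.2.eq_or_lt with rfl | hs1
    · rw [ContinuousWithinAt, hy1, Metric.tendsto_nhds]
      intro r hr
      have h1 : Tendsto (fun s : ℝ => r / 2 + (P + Q / (r / 2)) * (1 - s)) (𝓝[Ioc 0 1] 1)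
          (𝓝 (r / 2 + (P + Q / (r / 2)) * (1 - 1))) :=
        tendsto_nhdsWithin_of_tendsto_nhds (Continuous.tendsto (by fun_prop) 1)
      have h2 := h1.eventually_lt_const (u := r) (by simpa using hr)
      filter_upwards [h2, self_mem_nhdsWithin] with s h3 h4
      have h5 := hyub (r / 2) (half_pos hr) s ⟨h4.1.le, h4.2⟩
      have h6 : 0 ≤ y s := by
        rcases h4.2.eq_or_lt with rfl | h
        · exact hy1.ge
        · exact (hpos s ⟨h4.1, h⟩).le
      rw [Real.dist_eq, sub_zero, abs_of_nonneg h6]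
      linarith
    · exact ((hcont s ⟨hs.1, hs1⟩).continuousAt (Ioo_mem_nhds hs.1 hs1)).continuousWithinAt
  · intro s hs
    set a := s / 2
    set b := (s + 1) / 2
    have ha : 0 < a := half_pos hs.1
    have hb : b < 1 := by simp only [b]; linarith [hs.2]
    have has : a < s := half_lt_self hs.1
    have hsb : s < b := by simp only [b]; linarith [hs.2]
    obtain ⟨μ, hμ, N, h⟩ := hlow a b ha (has.trans hsb).le hb
    have hsub : Icc a b ⊆ Icc 0 1 := Icc_subset_Icc ha.le hb.le
    have hsub' : Icc a b ⊆ Ioo 0 1 := fun x hx => ⟨ha.trans_le hx.1, hx.2.trans_lt hb⟩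
    have hFc : ContinuousOn (fun t => p t - q t / y t) (Icc a b) :=
      (hp.mono hsub).sub ((hqc.mono hsub).div (hcont.mono hsub')
        fun t ht => (hpos t (hsub' ht)).ne')
    have hGc : ∀ n, ContinuousOn (fun t => p t - q t / max (Y n t) (e n)) (Icc a b) := fun n =>
      (hp.mono hsub).sub ((hqc.mono hsub).div
        (((hY n).continuousOn.mono hsub).sup continuousOn_const)
        fun t _ => (lt_max_of_lt_right (he0 n)).ne')
    -- dominated convergence in the integral form of the truncated equations
    have hint : ∀ t ∈ Icc a b, y t - y a = ∫ u in a..t, (p u - q u / y u) := by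
      intro t ht
      have hsubt : uIcc a t ⊆ Icc a b := by
        rw [uIcc_of_le ht.1]; exact Icc_subset_Icc le_rfl ht.2
      have hn : ∀ n, Y n t - Y n a = ∫ u in a..t, (p u - q u / max (Y n u) (e n)) := fun n =>
        (intervalIntegral.integral_eq_sub_of_hasDerivAt
          (fun u hu => (hY n).hasDerivAt u (hsub' (hsubt hu)))
          ((hGc n).mono hsubt).intervalIntegrable).symm
      have hl : Tendsto (fun n => ∫ u in a..t, (p u - q u / max (Y n u) (e n))) atTop
          (𝓝 (∫ u in a..t, (p u - q u / y u))) := by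
        refine intervalIntegral.tendsto_integral_filter_of_dominated_convergence
          (fun _ => P + Q / μ) ?_ ?_ (by simp) ?_
        · exact Eventually.of_forall fun n =>
            (((hGc n).mono hsubt).mono uIoc_subset_uIcc).aestronglyMeasurable measurableSet_uIoc
        · filter_upwards [eventually_ge_atTop N] with n hn
          refine Eventually.of_forall fun u hu => ?_
          have hu' := hsubt (uIoc_subset_uIcc hu)
          refine (norm_sub_le _ _).trans (add_le_add (hP u (hsub hu')) ?_)
          have hmx : μ ≤ max (Y n u) (e n) := (h n hn u hu').1.trans (le_max_left _ _)
          rw [norm_div, Real.norm_of_nonneg (hμ.le.trans hmx)]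
          gcongr
          exact hQ u (hsub hu')
        · refine Eventually.of_forall fun u hu => ?_
          have hu' := hsubt (uIoc_subset_uIcc hu)
          have h1 : Tendsto (fun n => max (Y n u) (e n)) atTop (𝓝 (max (y u) 0)) :=
            (hlim u (hsub hu')).max helim
          rw [max_eq_left (hpos u (hsub' hu')).le] at h1
          exact (tendsto_const_nhds.div h1 (hpos u (hsub' hu')).ne').const_sub (p u)
      refine tendsto_nhds_unique ?_ hl
      simp_rw [← hn]
      exact (hlim t (hsub ht)).sub (hlim a (hsub ⟨le_rfl, (has.trans hsb).le⟩))
    have hder : HasDerivAt (fun t => ∫ u in a..t, (p u - q u / y u)) (p s - q s / y s) s := by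
      refine intervalIntegral.integral_hasDerivAt_right
        ((hFc.mono ?_).intervalIntegrable) ?_ ?_
      · rw [uIcc_of_le has.le]; exact Icc_subset_Icc le_rfl hsb.le
      · exact hFc.stronglyMeasurableAtFilter_nhdsWithin measurableSet_Icc s |>.filter_mono
          (by rw [nhdsWithin_eq_nhds.2 (Icc_mem_nhds has hsb)])
      · exact hFc.continuousAt (Icc_mem_nhds has hsb)
    refine (hder.add_const (y a)).congr_of_eventuallyEq ?_
    filter_upwards [Icc_mem_nhds has hsb] with t ht
    rw [← hint t ht]; ring

namespace IsTerminalSolution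

variable {p p' q y y' : ℝ → ℝ}

/-- A supersolution which dominates `y` at `b` dominates it on all of `(0, b]`. -/
lemma le_of_supersolution (hy : IsTerminalSolution p q y) (hq : ∀ s ∈ Ioo (0 : ℝ) 1, 0 < q s)
    {w : ℝ → ℝ} {b : ℝ} (hb : b ≤ 1) (hw : ContinuousOn w (Ioc 0 b)) (hyb : y b ≤ w b)
    (hw' : ∀ s ∈ Ioo 0 b, 0 < w s ∧ ∃ d, HasDerivAt w d s ∧ d ≤ p s - q s / w s)
    {s : ℝ} (hs : s ∈ Ioc 0 b) : y s ≤ w s := by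
  by_contra! h
  have := le_of_deriv_nonneg_of_pos (d := fun t => y t - w t) hs.2
    ((hy.continuousOn.mono fun t ht => ⟨hs.1.trans_le ht.1, ht.2.trans hb⟩).sub
      (hw.mono fun t ht => ⟨hs.1.trans_le ht.1, ht.2⟩)) ?_ (by simpa using h)
  · linarith
  · intro t ht hpos
    have ht' : t ∈ Ioo (0 : ℝ) 1 := ⟨hs.1.trans ht.1, ht.2.trans_le hb⟩
    obtain ⟨h0, d, h1, h2⟩ := hw' t ⟨hs.1.trans ht.1, ht.2⟩
    refine ⟨_, (hy.hasDerivAt t ht').sub h1, ?_⟩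
    have h3 : q t / y t ≤ q t / w t :=
      div_le_div_of_nonneg_left (hq t ht').le h0 (by linarith)
    linarith

lemma antitone_of_le (hy : IsTerminalSolution p q y) (hy' : IsTerminalSolution p' q y')
    (hq : ∀ s ∈ Ioo (0 : ℝ) 1, 0 < q s) (hpp : ∀ s ∈ Ioo (0 : ℝ) 1, p s ≤ p' s) {s : ℝ}
    (hs : s ∈ Ioc (0 : ℝ) 1) : y' s ≤ y s :=
  hy'.le_of_supersolution hq le_rfl hy.continuousOn (by rw [hy.terminal, hy'.terminal])
    (fun t ht => ⟨hy.pos t ht, _, hy.hasDerivAt t ht, by linarith [hpp t ht]⟩) hs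

/-- Lipschitz dependence of the terminal solution on the convection term. -/
lemma le_add_of_le_add (hy : IsTerminalSolution p q y) (hy' : IsTerminalSolution p' q y')
    (hq : ∀ s ∈ Ioo (0 : ℝ) 1, 0 < q s) {θ : ℝ} (hθ : 0 ≤ θ)
    (hpp : ∀ s ∈ Ioo (0 : ℝ) 1, p' s ≤ p s + θ) {s : ℝ}
    (hs : s ∈ Ioc (0 : ℝ) 1) : y s ≤ y' s + θ * (1 - s) := by
  refine hy.le_of_supersolution (w := fun s => y' s + θ * (1 - s)) hq le_rfl
    (hy'.continuousOn.add (by fun_prop)) (by simp [hy.terminal, hy'.terminal])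
    (fun t ht => ?_) hs
  have hlin : HasDerivAt (fun t => θ * (1 - t)) (-θ) t := by
    simpa using (((hasDerivAt_id t).const_sub 1).const_mul θ)
  have h0 : 0 ≤ θ * (1 - t) := mul_nonneg hθ (by linarith [ht.2])
  have h1 := hy'.pos t ht
  refine ⟨by linarith, _, (hy'.hasDerivAt t ht).add hlin, ?_⟩
  have h2 : q t / (y' t + θ * (1 - t)) ≤ q t / y' t :=
    div_le_div_of_nonneg_left (hq t ht).le h1 (by linarith)
  linarith [hpp t ht]

end IsTerminalSolution

/-! ### Admissible speeds and the critical speed -/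

/-- The standing hypotheses on the convection `f`, the diffusivity `D` and the reaction `g`. -/
structure IsReactionDiffusionData (f D g : ℝ → ℝ) : Prop where
  contDiffOn_convection : ContDiffOn ℝ 1 f (Icc 0 1)
  convection_zero : f 0 = 0
  contDiffOn_diffusion : ContDiffOn ℝ 1 D (Icc 0 1)
  diffusion_pos : ∀ s ∈ Ioo (0 : ℝ) 1, 0 < D s
  diffusion_zero : D 0 = 0
  continuousOn_reaction : ContinuousOn g (Icc 0 1)
  reaction_pos : ∀ s ∈ Ioo (0 : ℝ) 1, 0 < g s
  reaction_zero : g 0 = 0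
  reaction_one : g 1 = 0

/-- `y` is the solution of the first-order problem satisfied by `y(φ) = -D(φ) φ'` along a profile
`φ` of speed `c`. -/
abbrev IsPhaseSolution (f D g : ℝ → ℝ) (c : ℝ) (y : ℝ → ℝ) : Prop :=
  IsTerminalSolution (fun s => c - derivWithin f (Icc 0 1) s) (fun s => D s * g s) y

/-- The speed `c` is admissible if its phase solution satisfies `y(s) ≤ c s - f(s)`; this is a
quantitative form of `y(0⁺) = 0`. -/
def IsAdmissibleSpeed (f D g : ℝ → ℝ) (c : ℝ) : Prop :=
  ∃ y, IsPhaseSolution f D g c y ∧ ∀ s ∈ Ioo (0 : ℝ) 1, y s ≤ c * s - f s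

lemma hasDerivAt_of_contDiffOn_Icc {f : ℝ → ℝ} (hf : ContDiffOn ℝ 1 f (Icc 0 1)) {s : ℝ}
    (hs : s ∈ Ioo (0 : ℝ) 1) : HasDerivAt f (derivWithin f (Icc 0 1) s) s :=
  ((hf.differentiableOn one_ne_zero) s (Ioo_subset_Icc_self hs)).hasDerivWithinAt.hasDerivAt
    (Icc_mem_nhds hs.1 hs.2)

lemma continuousOn_derivWithin_Icc {f : ℝ → ℝ} (hf : ContDiffOn ℝ 1 f (Icc 0 1)) :
    ContinuousOn (derivWithin f (Icc 0 1)) (Icc 0 1) :=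
  hf.continuousOn_derivWithin (uniqueDiffOn_Icc zero_lt_one) le_rfl

lemma nhdsGT_zero_le_Icc : 𝓝[>] (0 : ℝ) ≤ 𝓝[Icc 0 1] 0 := by
  rw [← nhdsWithin_Ioc_eq_nhdsGT (zero_lt_one' ℝ)]
  exact nhdsWithin_mono _ Ioc_subset_Icc_self

lemma tendsto_nhdsGT_of_continuousOn_Icc {f : ℝ → ℝ} (hf : ContinuousOn f (Icc 0 1)) :
    Tendsto f (𝓝[>] 0) (𝓝 (f 0)) :=
  (hf 0 (by simp)).tendsto.mono_left nhdsGT_zero_le_Icc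

lemma tendsto_div_self_of_contDiffOn_Icc {f : ℝ → ℝ} (hf : ContDiffOn ℝ 1 f (Icc 0 1))
    (h0 : f 0 = 0) :
    Tendsto (fun s => f s / s) (𝓝[>] 0) (𝓝 (derivWithin f (Icc 0 1) 0)) := by
  have h := ((hf.differentiableOn one_ne_zero) 0 (by simp)).hasDerivWithinAt
  rw [hasDerivWithinAt_iff_tendsto_slope] at h
  have h1 : 𝓝[>] (0 : ℝ) ≤ 𝓝[Icc 0 1 \ {0}] 0 := by
    rw [← nhdsWithin_Ioc_eq_nhdsGT (zero_lt_one' ℝ)]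
    exact nhdsWithin_mono _ fun x hx => ⟨Ioc_subset_Icc_self hx, hx.1.ne'⟩
  refine (h.mono_left h1).congr fun s => ?_
  simp [slope_def_field, h0]

lemma eventually_nhdsGT_zero_iff {P : ℝ → Prop} :
    (∀ᶠ s in 𝓝[>] (0 : ℝ), P s) ↔ ∃ δ ∈ Ioo (0 : ℝ) 1, ∀ s ∈ Ioc 0 δ, P s := by
  constructor
  · intro h
    obtain ⟨u, hu, h⟩ := (mem_nhdsGT_iff_exists_Ioc_subset).1 h
    refine ⟨min u (1 / 2), ⟨lt_min hu (by norm_num), (min_le_right _ _).trans_lt (by norm_num)⟩,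
      fun s hs => h ⟨hs.1, hs.2.trans (min_le_left _ _)⟩⟩
  · rintro ⟨δ, hδ, h⟩
    exact mem_of_superset (Ioc_mem_nhdsGT hδ.1) h

namespace IsReactionDiffusionData

variable {f D g : ℝ → ℝ}

lemma continuousOn_product (H : IsReactionDiffusionData f D g) :
    ContinuousOn (fun s => D s * g s) (Icc 0 1) :=
  H.contDiffOn_diffusion.continuousOn.mul H.continuousOn_reaction

lemma product_pos (H : IsReactionDiffusionData f D g) :
    ∀ s ∈ Ioo (0 : ℝ) 1, 0 < D s * g s :=
  fun s hs => mul_pos (H.diffusion_pos s hs) (H.reaction_pos s hs)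

lemma exists_isPhaseSolution (H : IsReactionDiffusionData f D g) (c : ℝ) :
    ∃ y, IsPhaseSolution f D g c y :=
  exists_isTerminalSolution
    (continuousOn_const.sub (continuousOn_derivWithin_Icc H.contDiffOn_convection))
    H.continuousOn_product H.product_pos

lemma tendsto_product_div (H : IsReactionDiffusionData f D g) :
    Tendsto (fun s => D s * g s / s) (𝓝[>] 0) (𝓝 0) := by
  have h1 := tendsto_div_self_of_contDiffOn_Icc H.contDiffOn_diffusion H.diffusion_zero
  have h2 := tendsto_nhdsGT_of_continuousOn_Icc H.continuousOn_reaction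
  have h3 := h1.mul h2
  rw [H.reaction_zero, mul_zero] at h3
  exact h3.congr fun s => by ring

lemma bddAbove_convection (H : IsReactionDiffusionData f D g) :
    BddAbove ((fun s => f s / s) '' Ioc (0 : ℝ) 1) := by
  obtain ⟨C, hC⟩ := isCompact_Icc.exists_bound_of_continuousOn
    (continuousOn_derivWithin_Icc H.contDiffOn_convection)
  refine ⟨C, ?_⟩
  rintro _ ⟨s, hs, rfl⟩
  have h := (convex_Icc (0 : ℝ) 1).norm_image_sub_le_of_norm_hasDerivWithin_le (f := f)
    (fun t ht => ((H.contDiffOn_convection.differentiableOn one_ne_zero) t ht).hasDerivWithinAt)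
    hC (left_mem_Icc.2 zero_le_one) (Ioc_subset_Icc_self hs)
  rw [H.convection_zero, sub_zero, sub_zero, Real.norm_of_nonneg hs.1.le] at h
  exact (div_le_iff₀ hs.1).2 ((le_abs_self _).trans h)

lemma le_supConvection_mul (H : IsReactionDiffusionData f D g) {s : ℝ} (hs : s ∈ Ioc (0 : ℝ) 1) :
    f s ≤ supConvection f * s :=
  (div_le_iff₀ hs.1).1 (le_csSup H.bddAbove_convection ⟨s, hs, rfl⟩)

lemma derivWithin_zero_le_supConvection (H : IsReactionDiffusionData f D g) :
    derivWithin f (Icc 0 1) 0 ≤ supConvection f := by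
  refine le_of_tendsto
    (tendsto_div_self_of_contDiffOn_Icc H.contDiffOn_convection H.convection_zero) ?_
  rw [eventually_nhdsGT_zero_iff]
  exact ⟨1 / 2, by norm_num, fun s hs =>
    le_csSup H.bddAbove_convection ⟨s, ⟨hs.1, hs.2.trans (by norm_num)⟩, rfl⟩⟩

/-- `D g / s` extends continuously to `s = 0` by its value `0 / 0 = 0`. -/
lemma continuousOn_product_div (H : IsReactionDiffusionData f D g) :
    ContinuousOn (fun s => D s * g s / s) (Icc 0 1) := by
  intro s hs
  rcases hs.1.eq_or_lt with rfl | h0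
  · have h : Icc (0 : ℝ) 1 ⊆ insert 0 (Ioi 0) := fun x hx => by
      rcases hx.1.eq_or_lt with h | h
      · exact Or.inl h.symm
      · exact Or.inr h
    refine ContinuousWithinAt.mono ?_ h
    rw [continuousWithinAt_insert_self, ContinuousWithinAt]
    simpa using H.tendsto_product_div
  · exact (H.continuousOn_product s hs).div continuousWithinAt_id h0.ne'

lemma product_div_nonneg (H : IsReactionDiffusionData f D g) :
    ∀ s ∈ Icc (0 : ℝ) 1, 0 ≤ D s * g s / s := by
  intro s hs
  rcases hs.1.eq_or_lt with rfl | h0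
  · simp
  rcases hs.2.eq_or_lt with rfl | h1
  · simp [H.reaction_one]
  · exact div_nonneg (H.product_pos s ⟨h0, h1⟩).le h0.le

lemma intervalIntegrable_product_div (H : IsReactionDiffusionData f D g) {s : ℝ}
    (hs : s ∈ Icc (0 : ℝ) 1) :
    IntervalIntegrable (fun s => D s * g s / s) volume 0 s :=
  (H.continuousOn_product_div.mono (by
    rw [uIcc_of_le hs.1]; exact Icc_subset_Icc le_rfl hs.2)).intervalIntegrable

lemma bddAbove_meanReaction (H : IsReactionDiffusionData f D g) :
    BddAbove ((fun s => (1 / s) * ∫ σ in (0 : ℝ)..s, D σ * g σ / σ) '' Ioc (0 : ℝ) 1) := by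
  obtain ⟨C, hC⟩ := isCompact_Icc.exists_bound_of_continuousOn H.continuousOn_product_div
  refine ⟨C, ?_⟩
  rintro _ ⟨s, hs, rfl⟩
  have h := intervalIntegral.norm_integral_le_of_norm_le_const (a := 0) (b := s)
    (f := fun σ => D σ * g σ / σ) (C := C) fun x hx => by
      rw [uIoc_of_le hs.1.le] at hx
      exact hC x ⟨hx.1.le, hx.2.trans hs.2⟩
  rw [sub_zero, abs_of_pos hs.1] at h
  simp only
  rw [one_div, inv_mul_eq_div, div_le_iff₀ hs.1]
  exact (le_abs_self _).trans h

lemma integral_le_supMeanReaction_mul (H : IsReactionDiffusionData f D g) {s : ℝ}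
    (hs : s ∈ Ioc (0 : ℝ) 1) :
    ∫ σ in (0 : ℝ)..s, D σ * g σ / σ ≤ supMeanReaction D g * s := by
  have h := le_csSup H.bddAbove_meanReaction ⟨s, hs, rfl⟩
  simp only [one_div, inv_mul_eq_div] at h
  have h2 := (div_le_iff₀ hs.1).1 h
  simpa [supMeanReaction, inv_mul_eq_div] using h2

lemma supMeanReaction_pos (H : IsReactionDiffusionData f D g) : 0 < supMeanReaction D g := by
  have h1 : 0 < ∫ σ in (0 : ℝ)..1, D σ * g σ / σ :=
    intervalIntegral.intervalIntegral_pos_of_pos_on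
      (H.intervalIntegrable_product_div (by simp))
      (fun x hx => div_pos (H.product_pos x hx) hx.1) zero_lt_one
  have h2 := H.integral_le_supMeanReaction_mul (s := 1) (by simp)
  linarith

lemma hasDerivAt_integral_product_div (H : IsReactionDiffusionData f D g) {s : ℝ}
    (hs : s ∈ Ioo (0 : ℝ) 1) :
    HasDerivAt (fun s => ∫ σ in (0 : ℝ)..s, D σ * g σ / σ) (D s * g s / s) s := by
  have hn := Icc_mem_nhds hs.1 hs.2
  refine intervalIntegral.integral_hasDerivAt_right
    (H.intervalIntegrable_product_div (Ioo_subset_Icc_self hs)) ?_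
    (H.continuousOn_product_div.continuousAt hn)
  exact (H.continuousOn_product_div.stronglyMeasurableAtFilter_nhdsWithin measurableSet_Icc s)
    |>.filter_mono (by rw [nhdsWithin_eq_nhds.2 hn])

lemma continuousOn_integral_product_div (H : IsReactionDiffusionData f D g) :
    ContinuousOn (fun s => ∫ σ in (0 : ℝ)..s, D σ * g σ / σ) (Icc 0 1) := by
  have h := intervalIntegral.continuousOn_primitive_interval
    (μ := volume) (f := fun σ => D σ * g σ / σ) (a := 0) (b := 1)
    ((H.continuousOn_product_div.mono (by rw [uIcc_of_le zero_le_one])).integrableOn_compact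
      isCompact_uIcc)
  rwa [uIcc_of_le zero_le_one] at h

lemma hasDerivAt_linear_sub (H : IsReactionDiffusionData f D g) (c : ℝ) {s : ℝ}
    (hs : s ∈ Ioo (0 : ℝ) 1) :
    HasDerivAt (fun s => c * s - f s) (c - derivWithin f (Icc 0 1) s) s := by
  simpa using ((hasDerivAt_id s).const_mul c).fun_sub
    (hasDerivAt_of_contDiffOn_Icc H.contDiffOn_convection hs)

lemma tendsto_linear_sub (H : IsReactionDiffusionData f D g) (c : ℝ) :
    Tendsto (fun s => c * s - f s) (𝓝[>] 0) (𝓝 0) := by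
  have := tendsto_nhdsGT_of_continuousOn_Icc (f := fun s => c * s - f s)
    ((continuousOn_const.mul continuousOn_id).sub H.contDiffOn_convection.continuousOn)
  simpa [H.convection_zero] using this

/-- Since `(y - (c s - f))' = -D g / y < 0`, vanishing of `y` at `0` bounds `y` by `c s - f`. -/
lemma le_of_tendsto_zero (H : IsReactionDiffusionData f D g) {c : ℝ} {y : ℝ → ℝ}
    (hy : IsPhaseSolution f D g c y) (h0 : Tendsto y (𝓝[>] 0) (𝓝 0)) {s : ℝ}
    (hs : s ∈ Ioo (0 : ℝ) 1) : y s ≤ c * s - f s := by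
  have hder : ∀ t ∈ Ioo (0 : ℝ) 1,
      HasDerivAt (fun t => y t - (c * t - f t)) (-(D t * g t / y t)) t := fun t ht => by
    refine ((hy.hasDerivAt t ht).fun_sub (H.hasDerivAt_linear_sub c ht)).congr_deriv ?_
    ring
  have hanti : AntitoneOn (fun t => y t - (c * t - f t)) (Ioo 0 1) := by
    refine antitoneOn_of_deriv_nonpos (convex_Ioo 0 1)
      (fun t ht => (hder t ht).continuousAt.continuousWithinAt) ?_ ?_
    · rw [interior_Ioo]
      exact fun t ht => (hder t ht).differentiableAt.differentiableWithinAt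
    · rw [interior_Ioo]
      intro t ht
      rw [(hder t ht).deriv]
      exact neg_nonpos.2 (div_nonneg (H.product_pos t ht).le (hy.pos t ht).le)
  have hlim : Tendsto (fun t => y t - (c * t - f t)) (𝓝[>] 0) (𝓝 0) := by
    simpa using h0.sub (H.tendsto_linear_sub c)
  have : y s - (c * s - f s) ≤ 0 := by
    refine ge_of_tendsto hlim ?_
    filter_upwards [Ioo_mem_nhdsGT hs.1] with t ht
    exact hanti ⟨ht.1, ht.2.trans hs.2⟩ hs ht.2.le
  linarith

lemma tendsto_zero_of_le (H : IsReactionDiffusionData f D g) {c c' : ℝ} {y : ℝ → ℝ}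
    (hy : IsPhaseSolution f D g c y) (h : ∀ s ∈ Ioo (0 : ℝ) 1, y s ≤ c' * s - f s) :
    Tendsto y (𝓝[>] 0) (𝓝 0) := by
  refine tendsto_of_tendsto_of_tendsto_of_le_of_le' tendsto_const_nhds
    (H.tendsto_linear_sub c') ?_ ?_
  · filter_upwards [Ioo_mem_nhdsGT zero_lt_one] with s hs using (hy.pos s hs).le
  · filter_upwards [Ioo_mem_nhdsGT zero_lt_one] with s hs using h s hs

lemma phaseSolution_le_of_le (H : IsReactionDiffusionData f D g) {c c' : ℝ} {y y' : ℝ → ℝ}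
    (hy : IsPhaseSolution f D g c y) (hy' : IsPhaseSolution f D g c' y') (hcc : c ≤ c') :
    ∀ s ∈ Ioc (0 : ℝ) 1, y' s ≤ y s := fun _ hs =>
  hy.antitone_of_le hy' H.product_pos (fun t _ => by simpa using hcc) hs

lemma le_of_isAdmissibleSpeed (H : IsReactionDiffusionData f D g) {c : ℝ} {y : ℝ → ℝ}
    (hc : IsAdmissibleSpeed f D g c) (hy : IsPhaseSolution f D g c y) :
    ∀ s ∈ Ioo (0 : ℝ) 1, y s ≤ c * s - f s := by
  obtain ⟨y', hy', h⟩ := hc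
  exact fun s hs => (H.phaseSolution_le_of_le hy' hy le_rfl s ⟨hs.1, hs.2.le⟩).trans (h s hs)

lemma supConvection_le (H : IsReactionDiffusionData f D g) {c : ℝ}
    (hc : IsAdmissibleSpeed f D g c) : supConvection f ≤ c := by
  obtain ⟨y, hy, h⟩ := hc
  have h1 : ∀ s ∈ Ioo (0 : ℝ) 1, 0 ≤ c * s - f s := fun s hs => (hy.pos s hs).le.trans (h s hs)
  have h2 : ∀ s ∈ Icc (0 : ℝ) 1, 0 ≤ c * s - f s := by
    have hcont : ContinuousOn (fun s => c * s - f s) (Icc 0 1) :=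
      (continuousOn_const.mul continuousOn_id).sub H.contDiffOn_convection.continuousOn
    have hcl : closure (Ioo (0 : ℝ) 1) = Icc 0 1 := closure_Ioo zero_ne_one
    intro s hs
    rw [← hcl] at hcont hs
    exact le_on_closure (f := fun _ => 0) h1 continuousOn_const hcont hs
  refine csSup_le ((nonempty_Ioc.2 zero_lt_one).image _) ?_
  rintro _ ⟨s, hs, rfl⟩
  rw [div_le_iff₀ hs.1]
  linarith [h2 s ⟨hs.1.le, hs.2⟩]

/-- With `M = supMeanReaction D g`, the function `c s - f(s) - M^{-1/2} ∫₀ˢ D g / σ` is a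
supersolution for the speed `c = supConvection f + 2 √M`, because it is at least `√M s`. -/
lemma isAdmissibleSpeed_upper (H : IsReactionDiffusionData f D g) :
    IsAdmissibleSpeed f D g (supConvection f + 2 * Real.sqrt (supMeanReaction D g)) := by
  set M := supMeanReaction D g with hM
  have hM0 : 0 < M := H.supMeanReaction_pos
  set r := Real.sqrt M with hr
  have hr0 : 0 < r := Real.sqrt_pos.2 hM0
  have hrr : r * r = M := Real.mul_self_sqrt hM0.le
  set c := supConvection f + 2 * r with hc
  obtain ⟨y, hy⟩ := H.exists_isPhaseSolution c
  refine ⟨y, hy, fun s hs => ?_⟩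
  set w : ℝ → ℝ := fun s => c * s - f s - (1 / r) * ∫ σ in (0 : ℝ)..s, D σ * g σ / σ with hw
  have hwlow : ∀ s ∈ Ioc (0 : ℝ) 1, r * s ≤ w s := by
    intro s hs
    have h1 := H.le_supConvection_mul hs
    have h2 : (1 / r) * ∫ σ in (0 : ℝ)..s, D σ * g σ / σ ≤ r * s := by
      calc _ ≤ (1 / r) * (M * s) :=
            mul_le_mul_of_nonneg_left (H.integral_le_supMeanReaction_mul hs) (by positivity)
        _ = r * s := by rw [← hrr]; field_simp
    simp only [hw, hc]
    linarith
  have hle : y s ≤ w s := by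
    refine hy.le_of_supersolution H.product_pos le_rfl ?_ ?_ ?_ (Ioo_subset_Ioc_self hs)
    · refine ContinuousOn.mono ?_ Ioc_subset_Icc_self
      exact ((continuousOn_const.mul continuousOn_id).sub
        H.contDiffOn_convection.continuousOn).sub
        (continuousOn_const.mul H.continuousOn_integral_product_div)
    · rw [hy.terminal]
      have := hwlow 1 (by simp)
      linarith
    · intro t ht
      have h1 := hwlow t (Ioo_subset_Ioc_self ht)
      have h2 : 0 < r * t := mul_pos hr0 ht.1
      refine ⟨by linarith, _, (H.hasDerivAt_linear_sub c ht).sub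
        ((H.hasDerivAt_integral_product_div ht).const_mul (1 / r)), ?_⟩
      have h3 : D t * g t / w t ≤ D t * g t / (r * t) :=
        div_le_div_of_nonneg_left (H.product_pos t ht).le h2 h1
      have h4 : 1 / r * (D t * g t / t) = D t * g t / (r * t) := by
        have := ht.1.ne'
        field_simp
      linarith
  have h5 : 0 ≤ (1 / r) * ∫ σ in (0 : ℝ)..s, D σ * g σ / σ := by
    refine mul_nonneg (by positivity) (intervalIntegral.integral_nonneg hs.1.le fun t ht => ?_)
    exact H.product_div_nonneg t ⟨ht.1, ht.2.trans hs.2.le⟩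
  simp only [hw] at hle
  linarith

lemma isAdmissibleSpeed_of_le (H : IsReactionDiffusionData f D g) {c c' : ℝ}
    (hc : IsAdmissibleSpeed f D g c) (hcc : c ≤ c') : IsAdmissibleSpeed f D g c' := by
  obtain ⟨y, hy, h⟩ := hc
  obtain ⟨y', hy'⟩ := H.exists_isPhaseSolution c'
  refine ⟨y', hy', fun s hs => ?_⟩
  have h1 := H.phaseSolution_le_of_le hy hy' hcc s (Ioo_subset_Ioc_self hs)
  have h2 := mul_le_mul_of_nonneg_right hcc hs.1.le
  linarith [h s hs]

lemma phaseSolution_le_add (H : IsReactionDiffusionData f D g) {c c' : ℝ} {y y' : ℝ → ℝ}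
    (hy : IsPhaseSolution f D g c y) (hy' : IsPhaseSolution f D g c' y') (hcc : c ≤ c') :
    ∀ s ∈ Ioc (0 : ℝ) 1, y s ≤ y' s + (c' - c) * (1 - s) := fun _ hs =>
  hy.le_add_of_le_add hy' H.product_pos (by linarith) (fun t _ => by linarith) hs

/-- The admissible speeds form a closed half-line `[c*, ∞)`. -/
theorem exists_criticalSpeed (H : IsReactionDiffusionData f D g) :
    ∃ cStar : ℝ, supConvection f ≤ cStar ∧
      cStar ≤ supConvection f + 2 * Real.sqrt (supMeanReaction D g) ∧
      ∀ c, IsAdmissibleSpeed f D g c ↔ cStar ≤ c := by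
  set S := {c | IsAdmissibleSpeed f D g c} with hS
  have hne : S.Nonempty := ⟨_, H.isAdmissibleSpeed_upper⟩
  have hbdd : BddBelow S := ⟨supConvection f, fun c hc => H.supConvection_le hc⟩
  have hmem : IsAdmissibleSpeed f D g (sInf S) := by
    obtain ⟨y, hy⟩ := H.exists_isPhaseSolution (sInf S)
    refine ⟨y, hy, fun s hs => le_of_forall_pos_le_add fun ε hε => ?_⟩
    obtain ⟨c, hcS, hc⟩ := exists_lt_of_csInf_lt hne (lt_add_of_pos_right (sInf S) hε)
    have hle : sInf S ≤ c := csInf_le hbdd hcS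
    obtain ⟨y', hy', h⟩ := hcS
    have h1 := H.phaseSolution_le_add hy hy' hle s (Ioo_subset_Ioc_self hs)
    have h2 := h s hs
    linarith [hs.1]
  exact ⟨sInf S, le_csInf hne fun c hc => H.supConvection_le hc,
    csInf_le hbdd H.isAdmissibleSpeed_upper, fun c =>
      ⟨fun hc => csInf_le hbdd hc, fun hc => H.isAdmissibleSpeed_of_le hmem hc⟩⟩

end IsReactionDiffusionData

/-! ### Behaviour of phase solutions at the equilibrium `0` -/

namespace IsReactionDiffusionData

variable {f D g : ℝ → ℝ}

lemma tendsto_derivWithin_convection (H : IsReactionDiffusionData f D g) :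
    Tendsto (derivWithin f (Icc 0 1)) (𝓝[>] 0) (𝓝 (derivWithin f (Icc 0 1) 0)) :=
  tendsto_nhdsGT_of_continuousOn_Icc (continuousOn_derivWithin_Icc H.contDiffOn_convection)

/-- If the phase solution vanishes at `0` at least linearly, then `D g / y → 0` and its slope at
`0` is the limit `c - f'(0)` of its derivative. -/
lemma tendsto_phaseSolution_div (H : IsReactionDiffusionData f D g) {c m : ℝ} {y : ℝ → ℝ}
    (hy : IsPhaseSolution f D g c y) (h0 : Tendsto y (𝓝[>] 0) (𝓝 0)) (hm : 0 < m)
    (hlow : ∀ᶠ s in 𝓝[>] 0, m * s ≤ y s) :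
    Tendsto (fun s => y s / s) (𝓝[>] 0) (𝓝 (c - derivWithin f (Icc 0 1) 0)) := by
  have hI : ∀ᶠ s : ℝ in 𝓝[>] 0, s ∈ Ioo (0 : ℝ) 1 := Ioo_mem_nhdsGT zero_lt_one
  have hquot : Tendsto (fun s => D s * g s / y s) (𝓝[>] 0) (𝓝 0) := by
    have h1 := H.tendsto_product_div.div_const m
    rw [zero_div] at h1
    refine tendsto_of_tendsto_of_tendsto_of_le_of_le' tendsto_const_nhds h1 ?_ ?_
    · filter_upwards [hI] with s hs using div_nonneg (H.product_pos s hs).le (hy.pos s hs).le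
    · filter_upwards [hI, hlow] with s hs h2
      rw [div_div, mul_comm s m]
      exact div_le_div_of_nonneg_left (H.product_pos s hs).le (mul_pos hm hs.1) h2
  -- `e` is `y` with the value at `0` set to its limit
  set e := Function.update y 0 0 with he
  have hey : ∀ s ∈ Ioi (0 : ℝ), e s = y s := fun s hs => Function.update_of_ne (ne_of_gt hs) _ _
  have hder : ∀ s ∈ Ioo (0 : ℝ) 1,
      HasDerivAt e (c - derivWithin f (Icc 0 1) s - D s * g s / y s) s := fun s hs => by
    refine (hy.hasDerivAt s hs).congr_of_eventuallyEq ?_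
    filter_upwards [Ioi_mem_nhds hs.1] with t ht using hey t ht
  have hmain : HasDerivWithinAt e (c - derivWithin f (Icc 0 1) 0) (Ici 0) 0 := by
    refine hasDerivWithinAt_Ici_of_tendsto_deriv (s := Ioo 0 1)
      (fun s hs => (hder s hs).differentiableAt.differentiableWithinAt) ?_
      (Ioo_mem_nhdsGT zero_lt_one) ?_
    · have : Tendsto e (𝓝[>] 0) (𝓝 (e 0)) := by
        simp only [he, Function.update_self]
        refine h0.congr' ?_
        filter_upwards [self_mem_nhdsWithin] with s hs using (hey s hs).symm
      exact this.mono_left (nhdsWithin_mono _ Ioo_subset_Ioi_self)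
    · have h2 := (H.tendsto_derivWithin_convection.const_sub c).sub hquot
      rw [sub_zero] at h2
      refine h2.congr' ?_
      filter_upwards [hI] with s hs using ((hder s hs).deriv).symm
  rw [hasDerivWithinAt_iff_tendsto_slope, Ici_sdiff_left] at hmain
  refine hmain.congr' ?_
  filter_upwards [self_mem_nhdsWithin] with s hs
  rw [slope_def_field, hey s hs]
  simp [he]

/-- At the critical speed, if it exceeds `f'(0)`, the phase solution leaves `0` with positive
slope: otherwise the line of slope `(c* - f'(0)) / 2` would be a supersolution near `0` for
slightly smaller speeds, which would then be admissible. -/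
lemma tendsto_phaseSolution_div_critical (H : IsReactionDiffusionData f D g) {cStar : ℝ}
    (hStar : ∀ c, IsAdmissibleSpeed f D g c ↔ cStar ≤ c)
    (hlt : derivWithin f (Icc 0 1) 0 < cStar) {y : ℝ → ℝ} (hy : IsPhaseSolution f D g cStar y) :
    Tendsto (fun s => y s / s) (𝓝[>] 0) (𝓝 (cStar - derivWithin f (Icc 0 1) 0)) := by
  have hadm := H.le_of_isAdmissibleSpeed ((hStar cStar).2 le_rfl) hy
  set k := cStar - derivWithin f (Icc 0 1) 0 with hk
  have hk0 : 0 < k := sub_pos.2 hlt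
  refine H.tendsto_phaseSolution_div hy (H.tendsto_zero_of_le hy hadm) (half_pos hk0) ?_
  have h1 : ∀ᶠ s in 𝓝[>] (0 : ℝ),
      derivWithin f (Icc 0 1) s < derivWithin f (Icc 0 1) 0 + k / 8 :=
    H.tendsto_derivWithin_convection.eventually_lt_const (by linarith)
  have h2 : ∀ᶠ s in 𝓝[>] (0 : ℝ), D s * g s / s < k ^ 2 / 16 :=
    H.tendsto_product_div.eventually_lt_const (by positivity)
  obtain ⟨δ, hδ, h⟩ := eventually_nhdsGT_zero_iff.1 (h1.and h2)
  rw [eventually_nhdsGT_zero_iff]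
  refine ⟨δ, hδ, fun s₁ hs₁ => ?_⟩
  by_contra! hcon
  have hs₁1 : s₁ < 1 := hs₁.2.trans_lt hδ.2
  -- `θ` is small enough for the line to remain a supersolution and to dominate `y' s₁`
  set θ := min (k / 4) (k / 2 * s₁ - y s₁) with hθ
  have hθ0 : 0 < θ := lt_min (by positivity) (by linarith)
  obtain ⟨y', hy'⟩ := H.exists_isPhaseSolution (cStar - θ)
  have hle : ∀ s ∈ Ioc 0 s₁, y' s ≤ k / 2 * s := by
    intro s hs
    refine hy'.le_of_supersolution (w := fun s => k / 2 * s) H.product_pos hs₁1.le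
      (by fun_prop) ?_ ?_ hs
    · have h3 := H.phaseSolution_le_add hy' hy (by linarith) s₁ ⟨hs₁.1, hs₁1.le⟩
      have h4 : (cStar - (cStar - θ)) * (1 - s₁) ≤ θ * 1 := by
        rw [sub_sub_cancel]
        exact mul_le_mul_of_nonneg_left (by linarith [hs₁.1]) hθ0.le
      have h5 : θ ≤ k / 2 * s₁ - y s₁ := min_le_right _ _
      linarith
    · intro t ht
      have ht' : t ∈ Ioc 0 δ := ⟨ht.1, ht.2.le.trans hs₁.2⟩
      obtain ⟨h3, h4⟩ := h t ht'
      refine ⟨mul_pos (half_pos hk0) ht.1, k / 2, ?_, ?_⟩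
      · simpa using (hasDerivAt_id t).const_mul (k / 2)
      · have h5 : D t * g t / (k / 2 * t) = D t * g t / t / (k / 2) := by
          rw [div_div, mul_comm t]
        have h6 : D t * g t / t / (k / 2) ≤ k / 8 := by
          rw [div_le_iff₀ (half_pos hk0)]
          linarith
        have h7 : θ ≤ k / 4 := min_le_left _ _
        linarith
  have hy'0 : Tendsto y' (𝓝[>] 0) (𝓝 0) := by
    have hlin : Tendsto (fun s => k / 2 * s) (𝓝[>] 0) (𝓝 (k / 2 * 0)) :=
      tendsto_nhdsWithin_of_tendsto_nhds (Continuous.tendsto (by fun_prop) 0)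
    rw [mul_zero] at hlin
    refine tendsto_of_tendsto_of_tendsto_of_le_of_le' tendsto_const_nhds hlin ?_ ?_
    · filter_upwards [Ioo_mem_nhdsGT zero_lt_one] with s hs using (hy'.pos s hs).le
    · filter_upwards [Ioc_mem_nhdsGT hs₁.1] with s hs using hle s hs
  have := (hStar (cStar - θ)).1 ⟨y', hy', fun s hs => H.le_of_tendsto_zero hy' hy'0 hs⟩
  linarith

/-- Above the critical speed `y / D → 0`. Otherwise `y > ε D` at points arbitrarily close to `0`;
there `D g / y < g / ε` is small, so `y` would grow linearly from such points on, its slope at `0`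
would be `c - f'(0)`, and this contradicts `y ≤ c* s - f(s)`. -/
lemma tendsto_phaseSolution_div_diffusion (H : IsReactionDiffusionData f D g) {c c' : ℝ}
    (hc' : IsAdmissibleSpeed f D g c') (hlt : c' < c) {y : ℝ → ℝ}
    (hy : IsPhaseSolution f D g c y) :
    Tendsto (fun s => y s / D s) (𝓝[>] 0) (𝓝 0) := by
  have hle : ∀ s ∈ Ioo (0 : ℝ) 1, y s ≤ c' * s - f s := by
    obtain ⟨y', hy', h⟩ := hc'
    exact fun s hs => (H.phaseSolution_le_of_le hy' hy hlt.le s (Ioo_subset_Ioc_self hs)).trans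
      (h s hs)
  have hc'0 : derivWithin f (Icc 0 1) 0 ≤ c' :=
    H.derivWithin_zero_le_supConvection.trans (H.supConvection_le hc')
  set k := c - derivWithin f (Icc 0 1) 0 with hk
  have hk0 : 0 < k := by linarith
  have hI : ∀ᶠ s : ℝ in 𝓝[>] 0, s ∈ Ioo (0 : ℝ) 1 := Ioo_mem_nhdsGT zero_lt_one
  -- it suffices to exclude linear growth
  have hno : ¬ ∀ᶠ s in 𝓝[>] 0, k / 4 * s ≤ y s := by
    intro hlow
    have h1 := H.tendsto_phaseSolution_div hy (H.tendsto_zero_of_le hy hle) (by positivity) hlow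
    have h2 : Tendsto (fun s => c' - f s / s) (𝓝[>] 0) (𝓝 (c' - derivWithin f (Icc 0 1) 0)) :=
      (tendsto_div_self_of_contDiffOn_Icc H.contDiffOn_convection H.convection_zero).const_sub c'
    have h3 : c - derivWithin f (Icc 0 1) 0 ≤ c' - derivWithin f (Icc 0 1) 0 := by
      refine le_of_tendsto_of_tendsto h1 h2 ?_
      filter_upwards [hI] with s hs
      rw [div_le_iff₀ hs.1, sub_mul, div_mul_cancel₀ _ hs.1.ne']
      exact hle s hs
    linarith
  rw [Metric.tendsto_nhds]
  intro ε₀ hε₀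
  by_contra hcon
  apply hno
  obtain ⟨B, hB⟩ := isCompact_Icc.exists_bound_of_continuousOn
    (continuousOn_derivWithin_Icc H.contDiffOn_diffusion)
  have hB0 : 0 ≤ B := (norm_nonneg _).trans (hB 0 (by simp))
  -- a smaller `ε` also makes `ε D'` negligible compared with the growth rate of `y`
  set ε := min ε₀ (k / (4 * (B + 1))) with hε
  have hε0 : 0 < ε := by positivity
  have hεB : ε * B ≤ k / 4 := by
    calc ε * B ≤ k / (4 * (B + 1)) * (B + 1) := by
          gcongr
          · exact min_le_right _ _
          · linarith
      _ = k / 4 := by field_simp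
  have h1 : ∀ᶠ s in 𝓝[>] (0 : ℝ),
      derivWithin f (Icc 0 1) s < derivWithin f (Icc 0 1) 0 + k / 4 :=
    H.tendsto_derivWithin_convection.eventually_lt_const (by linarith)
  have h2 : ∀ᶠ s in 𝓝[>] (0 : ℝ), g s < ε * (k / 8) := by
    have := tendsto_nhdsGT_of_continuousOn_Icc H.continuousOn_reaction
    rw [H.reaction_zero] at this
    exact this.eventually_lt_const (by positivity)
  obtain ⟨δ, hδ, h⟩ := eventually_nhdsGT_zero_iff.1 (h1.and h2)
  rw [eventually_nhdsGT_zero_iff]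
  refine ⟨δ, hδ, fun s hs => ?_⟩
  have hs1 : s < 1 := hs.2.trans_lt hδ.2
  refine le_of_forall_pos_le_add fun η hη => ?_
  -- a point `s₁ < s` close to `0` with `y s₁ > ε D s₁`
  have hfreq : ∃ᶠ t in 𝓝[>] (0 : ℝ), ¬ dist (y t / D t) 0 < ε₀ := not_eventually.1 hcon
  have hclose : ∀ᶠ t in 𝓝[>] (0 : ℝ), t ∈ Ioo 0 (min s (η / (k / 4))) :=
    Ioo_mem_nhdsGT (lt_min hs.1 (by positivity))
  obtain ⟨s₁, hs₁d, hs₁, hs₁I⟩ := (hfreq.and_eventually (hclose.and hI)).exists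
  have hs₁s : s₁ < s := hs₁.2.trans_le (min_le_left _ _)
  have hs₁η : k / 4 * s₁ ≤ η := by
    have := hs₁.2.le.trans (min_le_right _ _)
    rw [le_div_iff₀ (by positivity)] at this
    linarith
  have hD₁ := H.diffusion_pos s₁ hs₁I
  have hy₁ : ε * D s₁ ≤ y s₁ := by
    rw [Real.dist_eq, sub_zero, abs_of_pos (div_pos (hy.pos s₁ hs₁I) hD₁), not_lt,
      le_div_iff₀ hD₁] at hs₁d
    exact (mul_le_mul_of_nonneg_right (min_le_left _ _) hD₁.le).trans hs₁d
  -- halving `ε` makes the initial value of the compared function positive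
  have := le_of_deriv_nonneg_of_pos (d := fun t => y t - ε / 2 * D t - k / 4 * (t - s₁)) hs₁s.le
    ?_ ?_ ?_
  · have hDs := mul_pos (half_pos hε0) (H.diffusion_pos s ⟨hs.1, hs1⟩)
    have hDs₁ := mul_pos hε0 hD₁
    simp only [sub_self, mul_zero, sub_zero] at this
    linarith
  · refine ((hy.continuousOn.mono fun t ht => ⟨hs₁I.1.trans_le ht.1, ht.2.trans hs1.le⟩).sub
      (continuousOn_const.mul (H.contDiffOn_diffusion.continuousOn.mono
        (Icc_subset_Icc hs₁I.1.le hs1.le)))).sub (by fun_prop)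
  · intro t ht hpos
    have htI : t ∈ Ioo (0 : ℝ) 1 := ⟨hs₁I.1.trans ht.1, ht.2.trans hs1⟩
    obtain ⟨h3, h4⟩ := h t ⟨htI.1, ht.2.le.trans hs.2⟩
    have hlin : HasDerivAt (fun t => k / 4 * (t - s₁)) (k / 4) t := by
      simpa using ((hasDerivAt_id t).sub_const s₁).const_mul (k / 4)
    refine ⟨_, ((hy.hasDerivAt t htI).fun_sub ((hasDerivAt_of_contDiffOn_Icc
      H.contDiffOn_diffusion htI).const_mul (ε / 2))).fun_sub hlin, ?_⟩
    have hDt := H.diffusion_pos t htI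
    have hyt : ε / 2 * D t ≤ y t := by
      have : 0 ≤ k / 4 * (t - s₁) := mul_nonneg (by positivity) (by linarith [ht.1])
      linarith
    have h5 : D t * g t / y t ≤ k / 4 := by
      rw [div_le_iff₀ (hy.pos t htI)]
      calc D t * g t ≤ D t * (ε * (k / 8)) := mul_le_mul_of_nonneg_left h4.le hDt.le
        _ = k / 4 * (ε / 2 * D t) := by ring
        _ ≤ k / 4 * y t := mul_le_mul_of_nonneg_left hyt (by positivity)
    have h6 : ε / 2 * derivWithin D (Icc 0 1) t ≤ k / 8 := by
      have h7 : derivWithin D (Icc 0 1) t ≤ B :=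
        (le_abs_self _).trans (hB t (Ioo_subset_Icc_self htI))
      have h8 := mul_le_mul_of_nonneg_left h7 (half_pos hε0).le
      linarith
    linarith
  · have := mul_pos hε0 hD₁
    simp only [sub_self, mul_zero, sub_zero]
    linarith

end IsReactionDiffusionData

/-! ### The weak equation and the flux -/

lemma integrable_mul_of_hasCompactSupport {u ψ : ℝ → ℝ} (hu : LocallyIntegrable u)
    (hψ : Continuous ψ) (hc : HasCompactSupport ψ) : Integrable (fun x => u x * ψ x) := by
  have := hu.integrable_smul_left_of_hasCompactSupport hψ hc
  simpa [mul_comm] using this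

/-- A primitive of a test function of vanishing integral is a test function. -/
lemma exists_testFunction_deriv_eq {θ : ℝ → ℝ} (hθ : ContDiff ℝ ∞ θ) (hc : HasCompactSupport θ)
    (h0 : ∫ x, θ x = 0) : ∃ ψ : ℝ → ℝ, ContDiff ℝ ∞ ψ ∧ HasCompactSupport ψ ∧ deriv ψ = θ := by
  obtain ⟨R, hR⟩ := hc.isCompact.isBounded.subset_closedBall 0
  have hout : ∀ x, x ∉ Icc (-R) R → θ x = 0 := fun x hx => by
    by_contra h
    have := hR (subset_tsupport _ h)
    rw [Real.closedBall_eq_Icc] at this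
    simp only [zero_sub, zero_add] at this
    exact hx this
  have hder : ∀ x, HasDerivAt (fun x => ∫ t in (-R)..x, θ t) (θ x) x := fun x =>
    hθ.continuous.integral_hasStrictDerivAt (-R) x |>.hasDerivAt
  have hd : deriv (fun x => ∫ t in (-R)..x, θ t) = θ := funext fun x => (hder x).deriv
  refine ⟨fun x => ∫ t in (-R)..x, θ t, ?_, ?_, hd⟩
  · rw [contDiff_infty_iff_deriv, hd]
    exact ⟨fun x => (hder x).differentiableAt, hθ⟩
  · refine HasCompactSupport.intro (isCompact_Icc (a := -R) (b := R)) fun x hx => ?_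
    rw [mem_Icc, not_and_or, not_le, not_le] at hx
    rcases hx with hx | hx
    · rw [intervalIntegral.integral_symm, intervalIntegral.integral_of_le hx.le,
        integral_Ioc_eq_integral_Ioo, setIntegral_eq_zero_of_forall_eq_zero, neg_zero]
      intro t ht
      exact hout t fun h => absurd h.1 (not_le.2 ht.2)
    · rcases le_or_gt (-R) x with hRx | hRx
      · rw [intervalIntegral.integral_of_le hRx, ← integral_Icc_eq_integral_Ioc,
          setIntegral_eq_integral_of_forall_compl_eq_zero, h0]
        intro t ht
        exact hout t fun h => ht ⟨h.1, h.2.trans hx.le⟩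
      · rw [intervalIntegral.integral_symm, intervalIntegral.integral_of_le hRx.le,
          setIntegral_eq_zero_of_forall_eq_zero, neg_zero]
        intro t ht
        exact hout t fun h => absurd (h.2.trans_lt hx) (not_lt.2 ht.1.le)

/-- The du Bois-Reymond lemma: a locally integrable function with vanishing weak derivative is
almost everywhere constant. -/
lemma exists_ae_eq_const_of_integral_mul_deriv_eq_zero {u : ℝ → ℝ} (hu : LocallyIntegrable u)
    (h : ∀ ψ : ℝ → ℝ, ContDiff ℝ ∞ ψ → HasCompactSupport ψ → ∫ x, u x * deriv ψ x = 0) :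
    ∃ C, ∀ᵐ x, u x = C := by
  let b : ContDiffBump (0 : ℝ) := default
  set η : ℝ → ℝ := b.normed volume with hη
  have hηs : ContDiff ℝ ∞ η := b.contDiff_normed
  have hηc : HasCompactSupport η := b.hasCompactSupport_normed
  have hη1 : ∫ x, η x = 1 := b.integral_normed
  have hηi : Integrable η := b.integrable_normed
  set C := ∫ x, u x * η x with hC
  refine ⟨C, ?_⟩
  have := ae_eq_zero_of_integral_contDiff_smul_eq_zero (μ := volume) (f := fun x => u x - C)
    (hu.sub (locallyIntegrable_const C)) ?_
  · filter_upwards [this] with x hx using sub_eq_zero.1 hx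
  intro χ hχ hχc
  have hχi : Integrable χ := hχ.continuous.integrable_of_hasCompactSupport hχc
  set I := ∫ x, χ x with hI
  have huχ := integrable_mul_of_hasCompactSupport hu hχ.continuous hχc
  have huη := integrable_mul_of_hasCompactSupport hu hηs.continuous hηc
  obtain ⟨ψ, hψ, hψc, hψd⟩ := exists_testFunction_deriv_eq (θ := fun x => χ x - I * η x)
    (hχ.sub (contDiff_const.mul hηs)) (hχc.sub hηc.mul_left)
    (by rw [integral_sub hχi (hηi.const_mul I), integral_const_mul, hη1, mul_one, sub_self])
  have h1 := h ψ hψ hψc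
  rw [hψd] at h1
  have h2 : ∀ x, u x * (χ x - I * η x) = u x * χ x - I * (u x * η x) := fun x => by ring
  simp_rw [h2] at h1
  rw [integral_sub huχ (huη.const_mul I), integral_const_mul] at h1
  have h3 : ∀ x, χ x • (u x - C) = u x * χ x - C * χ x := fun x => by
    rw [smul_eq_mul]; ring
  simp_rw [h3]
  rw [integral_sub huχ (hχi.const_mul C), integral_const_mul]
  linarith

/-- `V` is a continuous representative of the diffusive flux `D(φ) φ'`, and the total flux
`V - f(φ) + c φ` has derivative `-g(φ)`. -/
structure IsFlux (f D g : ℝ → ℝ) (c : ℝ) (φ V : ℝ → ℝ) : Prop where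
  continuous : Continuous V
  ae_eq : ∀ᵐ ξ, D (φ ξ) * deriv φ ξ = V ξ
  hasDerivAt : ∀ ξ, HasDerivAt (fun ξ => V ξ - f (φ ξ) + c * φ ξ) (-g (φ ξ)) ξ

namespace IsReactionDiffusionData

variable {f D g φ V : ℝ → ℝ} {c : ℝ}

lemma exists_isFlux (H : IsReactionDiffusionData f D g)
    (hφ : IsTravelingWave f D g univ c φ) : ∃ V, IsFlux f D g c φ V := by
  have hc : Continuous φ := continuousOn_univ.1 hφ.continuousOn
  have hI : ∀ ξ, φ ξ ∈ Icc (0 : ℝ) 1 := fun ξ => hφ.mem_Icc ξ (mem_univ _)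
  have hfφ : Continuous fun ξ => f (φ ξ) :=
    H.contDiffOn_convection.continuousOn.comp_continuous hc hI
  have hgφ : Continuous fun ξ => g (φ ξ) := H.continuousOn_reaction.comp_continuous hc hI
  have hDφ : LocallyIntegrable fun ξ => D (φ ξ) * deriv φ ξ :=
    locallyIntegrableOn_univ.1 hφ.locallyIntegrableOn
  set G : ℝ → ℝ := fun x => ∫ t in (0 : ℝ)..x, g (φ t) with hG
  have hGd : ∀ x, HasDerivAt G (g (φ x)) x := fun x =>
    (hgφ.integral_hasStrictDerivAt 0 x).hasDerivAt
  have hGc : Continuous G := continuous_iff_continuousAt.2 fun x => (hGd x).continuousAt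
  have hwi : LocallyIntegrable fun ξ => D (φ ξ) * deriv φ ξ - f (φ ξ) + c * φ ξ :=
    (hDφ.sub hfφ.locallyIntegrable).add (continuous_const.mul hc).locallyIntegrable
  obtain ⟨C, hC⟩ := exists_ae_eq_const_of_integral_mul_deriv_eq_zero
    (u := fun ξ => (D (φ ξ) * deriv φ ξ - f (φ ξ) + c * φ ξ) + G ξ)
    (hwi.add hGc.locallyIntegrable) (by
      intro ψ hψ hψc
      have hψ' : Continuous (deriv ψ) := hψ.continuous_deriv (by simp)
      have hψc' : HasCompactSupport (deriv ψ) := hψc.deriv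
      have h1 := integrable_mul_of_hasCompactSupport hwi hψ' hψc'
      have h2 := integrable_mul_of_hasCompactSupport hGc.locallyIntegrable hψ' hψc'
      have h3 := integrable_mul_of_hasCompactSupport hgφ.locallyIntegrable hψ.continuous hψc
      have h4 := integrable_mul_of_hasCompactSupport hGc.locallyIntegrable hψ.continuous hψc
      have h5 : ∫ x, G x * deriv ψ x = -∫ x, g (φ x) * ψ x :=
        integral_mul_deriv_eq_deriv_mul_of_integrable (fun x _ => hGd x)
          (fun x _ => (hψ.differentiable (by simp) x).hasDerivAt) h2 h3 h4
      have h6 := hφ.weak_eq ψ hψ hψc (subset_univ _)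
      rw [setIntegral_univ, integral_sub h1 h3] at h6
      simp_rw [add_mul _ (G _)]
      rw [integral_add h1 h2, h5]
      linarith)
  refine ⟨fun ξ => C - G ξ + f (φ ξ) - c * φ ξ, ?_, ?_, fun ξ => ?_⟩
  · exact ((continuous_const.sub hGc).add hfφ).sub (continuous_const.mul hc)
  · filter_upwards [hC] with ξ hξ
    linarith
  · have h1 : (fun ξ => C - G ξ + f (φ ξ) - c * φ ξ - f (φ ξ) + c * φ ξ) = fun ξ => C - G ξ := by
      ext; ring
    rw [h1]
    exact (hGd ξ).const_sub C

lemma isTravelingWave_of_isFlux (H : IsReactionDiffusionData f D g) (hc : Continuous φ)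
    (hI : ∀ ξ, φ ξ ∈ Icc (0 : ℝ) 1) (hac : LocallyAC φ univ)
    (hdiff : ∀ᵐ ξ, DifferentiableAt ℝ φ ξ) (hV : IsFlux f D g c φ V) :
    IsTravelingWave f D g univ c φ where
  isOpen := isOpen_univ
  ordConnected := ordConnected_univ
  continuousOn := hc.continuousOn
  mem_Icc := fun ξ _ => hI ξ
  locallyAC := hac
  ae_differentiableAt := by rwa [Measure.restrict_univ]
  locallyIntegrableOn := by
    rw [locallyIntegrableOn_univ]
    exact hV.continuous.locallyIntegrable.congr (hV.ae_eq.mono fun ξ h => h.symm)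
  weak_eq := by
    intro ψ hψ hψc _
    have hgφ : Continuous fun ξ => g (φ ξ) := H.continuousOn_reaction.comp_continuous hc hI
    have hψ' : Continuous (deriv ψ) := hψ.continuous_deriv (by simp)
    have hw : Continuous fun ξ => V ξ - f (φ ξ) + c * φ ξ :=
      continuous_iff_continuousAt.2 fun x => (hV.hasDerivAt x).continuousAt
    have h2 := integrable_mul_of_hasCompactSupport hw.locallyIntegrable hψ' hψc.deriv
    have h3 := integrable_mul_of_hasCompactSupport hgφ.neg.locallyIntegrable hψ.continuous hψc
    have h4 := integrable_mul_of_hasCompactSupport hw.locallyIntegrable hψ.continuous hψc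
    have h3' := integrable_mul_of_hasCompactSupport hgφ.locallyIntegrable hψ.continuous hψc
    have h5 := integral_mul_deriv_eq_deriv_mul_of_integrable (fun x _ => hV.hasDerivAt x)
          (fun x _ => (hψ.differentiable (by simp) x).hasDerivAt) h2 h3 h4
    rw [setIntegral_univ]
    have h6 : ∫ ξ, ((D (φ ξ) * deriv φ ξ - f (φ ξ) + c * φ ξ) * deriv ψ ξ - g (φ ξ) * ψ ξ)
        = ∫ ξ, ((V ξ - f (φ ξ) + c * φ ξ) * deriv ψ ξ - g (φ ξ) * ψ ξ) := by
      refine integral_congr_ae ?_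
      filter_upwards [hV.ae_eq] with ξ hξ
      rw [hξ]
    rw [h6, integral_sub h2 h3', h5]
    simp only [neg_mul, integral_neg]
    ring

end IsReactionDiffusionData

/-! ### From wavefronts to phase solutions -/

/-- A function with values in `[0,1]` cannot have derivative `≤ -m` on an interval of length
`2 / m`. -/
lemma exists_mem_Icc_not_deriv_le {φ : ℝ → ℝ} (hI : ∀ ξ, φ ξ ∈ Icc (0 : ℝ) 1) {m : ℝ} (hm : 0 < m)
    (a : ℝ) : ∃ ξ ∈ Icc a (a + 2 / m), ¬ ∃ d, HasDerivAt φ d ξ ∧ d ≤ -m := by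
  by_contra! hcon
  have hL : 0 < 2 / m := by positivity
  have hab : a ≤ a + 2 / m := by linarith
  have h := (convex_Icc a (a + 2 / m)).image_sub_le_mul_sub_of_deriv_le (f := φ) (C := -m)
    (fun ξ hξ => by
      obtain ⟨d, h1, -⟩ := hcon ξ hξ
      exact h1.continuousAt.continuousWithinAt)
    (fun ξ hξ => by
      obtain ⟨d, h1, -⟩ := hcon ξ (interior_subset hξ)
      exact h1.differentiableAt.differentiableWithinAt)
    (fun ξ hξ => by
      obtain ⟨d, h1, h2⟩ := hcon ξ (interior_subset hξ)
      rwa [h1.deriv])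
    a (left_mem_Icc.2 hab) _ (right_mem_Icc.2 hab) hab
  have h1 : -m * (a + 2 / m - a) = -2 := by field_simp; ring
  rw [h1] at h
  linarith [(hI a).2, (hI (a + 2 / m)).1]

/-- The mirror image of `le_of_deriv_nonneg_of_pos`. -/
lemma le_of_deriv_nonpos_of_pos {d : ℝ → ℝ} {a b : ℝ} (hab : a ≤ b)
    (hc : ContinuousOn d (Icc a b))
    (hd : ∀ s ∈ Ioo a b, 0 < d s → ∃ d', HasDerivAt d d' s ∧ d' ≤ 0) (hb : 0 < d b) :
    d b ≤ d a := by
  have := le_of_deriv_nonneg_of_pos (d := fun t => d (-t)) (neg_le_neg hab)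
    (hc.comp continuousOn_neg fun t ht => ⟨by linarith [ht.2], by linarith [ht.1]⟩) ?_
    (by simpa using hb)
  · simpa using this
  · intro t ht hpos
    obtain ⟨d', h1, h2⟩ := hd (-t) ⟨by linarith [ht.2], by linarith [ht.1]⟩ hpos
    exact ⟨_, h1.comp t (hasDerivAt_neg t), by linarith⟩

namespace IsWavefront

variable {f D g φ : ℝ → ℝ} {c : ℝ}

lemma continuous (W : IsWavefront f D g c φ) : Continuous φ :=
  continuousOn_univ.1 W.travelingWave.continuousOn

lemma mem_Icc (W : IsWavefront f D g c φ) (ξ : ℝ) : φ ξ ∈ Icc (0 : ℝ) 1 :=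
  W.travelingWave.mem_Icc ξ (mem_univ _)

lemma antitone (W : IsWavefront f D g c φ) : Antitone φ := by
  rcases W.monotonic with h | h
  · have h1 := h.le_of_tendsto W.tendsto_atBot 0
    have h2 := h.ge_of_tendsto W.tendsto_atTop 0
    linarith
  · exact h

lemma exists_eq (W : IsWavefront f D g c φ) {s : ℝ} (hs : s ∈ Ioo (0 : ℝ) 1) : ∃ ξ, φ ξ = s := by
  obtain ⟨a, ha⟩ := (W.tendsto_atTop.eventually_lt_const hs.1).exists
  obtain ⟨b, hb⟩ := (W.tendsto_atBot.eventually_const_lt hs.2).exists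
  exact mem_range_of_exists_le_of_exists_ge W.continuous ⟨a, ha.le⟩ ⟨b, hb.le⟩

lemma isOpen_interior (W : IsWavefront f D g c φ) : IsOpen {ξ | φ ξ ∈ Ioo (0 : ℝ) 1} :=
  isOpen_Ioo.preimage W.continuous

lemma continuous_comp (W : IsWavefront f D g c φ) {u : ℝ → ℝ} (hu : ContinuousOn u (Icc 0 1)) :
    Continuous fun ξ => u (φ ξ) :=
  hu.comp_continuous W.continuous W.mem_Icc

end IsWavefront

namespace IsReactionDiffusionData

variable {f D g φ V y : ℝ → ℝ} {c : ℝ}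

/-- Where `0 < φ < 1` the relation `D(φ) φ' = V` holds everywhere and makes `φ` continuously
differentiable. -/
lemma hasDerivAt_profile (H : IsReactionDiffusionData f D g) (W : IsWavefront f D g c φ)
    (hV : IsFlux f D g c φ V) {ξ : ℝ} (hξ : φ ξ ∈ Ioo (0 : ℝ) 1) :
    HasDerivAt φ (V ξ / D (φ ξ)) ξ := by
  obtain ⟨r, hr, hball⟩ := Metric.isOpen_iff.1 W.isOpen_interior ξ hξ
  rw [Real.ball_eq_Ioo] at hball
  set a := ξ - r / 2 with ha
  set b := ξ + r / 2 with hb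
  have hsub : Icc a b ⊆ {ξ | φ ξ ∈ Ioo (0 : ℝ) 1} := fun x hx =>
    hball ⟨by linarith [hx.1], by linarith [hx.2]⟩
  have hab : a ≤ b := by linarith
  have hcont : ContinuousOn (fun x => V x / D (φ x)) (Icc a b) :=
    hV.continuous.continuousOn.div
      (W.continuous_comp H.contDiffOn_diffusion.continuousOn).continuousOn
      fun x hx => (H.diffusion_pos _ (hsub hx)).ne'
  have hint : ∀ x ∈ Icc a b, φ x - φ a = ∫ t in a..x, V t / D (φ t) := by
    intro x hx
    rw [← (W.travelingWave.locallyAC a x (subset_univ _)).integral_deriv_eq_sub]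
    refine intervalIntegral.integral_congr_ae ?_
    filter_upwards [hV.ae_eq] with t ht htI
    rw [uIoc_of_le hx.1] at htI
    have := H.diffusion_pos _ (hsub ⟨htI.1.le, htI.2.trans hx.2⟩)
    rw [← ht]
    field_simp
  have hn : Icc a b ∈ 𝓝 ξ := Icc_mem_nhds (by linarith) (by linarith)
  have hder : HasDerivAt (fun x => ∫ t in a..x, V t / D (φ t)) (V ξ / D (φ ξ)) ξ := by
    refine intervalIntegral.integral_hasDerivAt_right
      ((hcont.mono ?_).intervalIntegrable) ?_ (hcont.continuousAt hn)
    · rw [uIcc_of_le (by linarith)]; exact Icc_subset_Icc le_rfl (by linarith)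
    · exact (hcont.stronglyMeasurableAtFilter_nhdsWithin measurableSet_Icc ξ).filter_mono
        (by rw [nhdsWithin_eq_nhds.2 hn])
  refine (hder.add_const (φ a)).congr_of_eventuallyEq ?_
  filter_upwards [hn] with x hx
  rw [← hint x hx]; ring

/-- The flux vanishes where the profile is at an equilibrium. -/
lemma flux_eq_zero (H : IsReactionDiffusionData f D g) (W : IsWavefront f D g c φ)
    (hV : IsFlux f D g c φ V) {ξ : ℝ} (hξ : φ ξ ∉ Ioo (0 : ℝ) 1) : V ξ = 0 := by
  have hcl : ∀ S : Set ℝ, IsOpen S → (∀ᵐ x, x ∈ S → V x = 0) → ξ ∈ closure S → V ξ = 0 := by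
    intro S hS hae hmem
    have h1 : EqOn V (fun _ => (0 : ℝ)) S :=
      Measure.eqOn_open_of_ae_eq (μ := volume) ((ae_restrict_iff' hS.measurableSet).2 hae) hS
        hV.continuous.continuousOn continuousOn_const
    exact (h1.closure hV.continuous continuous_const) hmem
  have hI := W.mem_Icc ξ
  rw [mem_Ioo, not_and_or, not_lt, not_lt] at hξ
  rcases hξ with h | h
  · refine hcl (Ioi ξ) isOpen_Ioi ?_ (by simp)
    filter_upwards [hV.ae_eq] with x hx hxξ
    have : φ x = 0 := le_antisymm ((W.antitone (le_of_lt hxξ)).trans h) (W.mem_Icc x).1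
    rw [← hx, this, H.diffusion_zero, zero_mul]
  · refine hcl (Iio ξ) isOpen_Iio ?_ (by simp)
    filter_upwards [hV.ae_eq] with x hx hxξ
    have h1 : φ =ᶠ[𝓝 x] fun _ => 1 := by
      filter_upwards [Iio_mem_nhds hxξ] with t ht
      exact le_antisymm (W.mem_Icc t).2 (h.trans (W.antitone (le_of_lt ht)))
    rw [← hx, h1.deriv_eq, deriv_const, mul_zero]

lemma hasDerivAt_flux (H : IsReactionDiffusionData f D g) (W : IsWavefront f D g c φ)
    (hV : IsFlux f D g c φ V) {ξ : ℝ} (hξ : φ ξ ∈ Ioo (0 : ℝ) 1) :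
    HasDerivAt V (-(c - derivWithin f (Icc 0 1) (φ ξ)) * (V ξ / D (φ ξ)) - g (φ ξ)) ξ := by
  have h1 := H.hasDerivAt_profile W hV hξ
  have h2 := (hV.hasDerivAt ξ).fun_sub ((H.hasDerivAt_linear_sub c hξ).comp ξ h1)
  refine (h2.congr_of_eventuallyEq (Eventually.of_forall fun x => ?_)).congr_deriv ?_
  · simp only [Function.comp]
    ring
  · ring

lemma flux_nonpos (H : IsReactionDiffusionData f D g) (W : IsWavefront f D g c φ)
    (hV : IsFlux f D g c φ V) (ξ : ℝ) : V ξ ≤ 0 := by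
  by_cases hξ : φ ξ ∈ Ioo (0 : ℝ) 1
  · have h1 := (H.hasDerivAt_profile W hV hξ).deriv
    have h2 : deriv φ ξ ≤ 0 := W.antitone.deriv_nonpos
    rw [h1] at h2
    have h3 := H.diffusion_pos _ hξ
    rw [div_le_iff₀ h3, zero_mul] at h2
    exact h2
  · exact (H.flux_eq_zero W hV hξ).le

/-- The flux becomes small on every sufficiently long interval. -/
lemma exists_flux_gt (H : IsReactionDiffusionData f D g) (W : IsWavefront f D g c φ)
    (hV : IsFlux f D g c φ V) {δ : ℝ} (hδ : 0 < δ) :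
    ∃ L : ℝ, 0 < L ∧ ∀ a, ∃ ξ ∈ Icc a (a + L), -δ < V ξ := by
  obtain ⟨B, hB⟩ := isCompact_Icc.exists_bound_of_continuousOn H.contDiffOn_diffusion.continuousOn
  have hB0 : 0 ≤ B := (norm_nonneg _).trans (hB 0 (by simp))
  have hm : 0 < δ / (B + 1) := by positivity
  refine ⟨2 / (δ / (B + 1)), by positivity, fun a => ?_⟩
  obtain ⟨ξ, hξ, hn⟩ := exists_mem_Icc_not_deriv_le W.mem_Icc hm a
  refine ⟨ξ, hξ, ?_⟩
  by_contra! hle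
  apply hn
  have hI : φ ξ ∈ Ioo (0 : ℝ) 1 := by
    by_contra h
    rw [H.flux_eq_zero W hV h] at hle
    linarith
  refine ⟨_, H.hasDerivAt_profile W hV hI, ?_⟩
  have hD := H.diffusion_pos _ hI
  have hDB : D (φ ξ) ≤ B + 1 := by
    have := (le_abs_self _).trans (hB _ (W.mem_Icc ξ))
    linarith
  rw [div_le_iff₀ hD]
  have : δ / (B + 1) * D (φ ξ) ≤ δ / (B + 1) * (B + 1) := by gcongr
  have h2 : δ / (B + 1) * (B + 1) = δ := by field_simp
  linarith

/-- The total flux `V - f(φ) + c φ` is nonincreasing and tends to `0` along a sequence going to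
`+∞`, hence it is nonnegative. -/
lemma neg_flux_le (H : IsReactionDiffusionData f D g) (W : IsWavefront f D g c φ)
    (hV : IsFlux f D g c φ V) (ξ : ℝ) : -V ξ ≤ c * φ ξ - f (φ ξ) := by
  by_contra! hlt
  set w : ℝ → ℝ := fun ξ => V ξ - f (φ ξ) + c * φ ξ with hw
  have hwneg : w ξ < 0 := by simp only [hw]; linarith
  have hg0 : ∀ x, 0 ≤ g (φ x) := fun x => by
    by_cases hx : φ x ∈ Ioo (0 : ℝ) 1
    · exact (H.reaction_pos _ hx).le
    · have hI := W.mem_Icc x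
      rw [mem_Ioo, not_and_or, not_lt, not_lt] at hx
      rcases hx with h | h
      · rw [le_antisymm h hI.1, H.reaction_zero]
      · rw [le_antisymm hI.2 h, H.reaction_one]
  have hanti : Antitone w := antitone_of_deriv_nonpos
    (fun x => (hV.hasDerivAt x).differentiableAt) fun x => by
      rw [(hV.hasDerivAt x).deriv]; exact neg_nonpos.2 (hg0 x)
  have hlim : Tendsto (fun x => c * φ x - f (φ x)) atTop (𝓝 0) := by
    have h1 : ContinuousOn (fun s => c * s - f s) (Icc 0 1) :=
      (continuousOn_const.mul continuousOn_id).sub H.contDiffOn_convection.continuousOn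
    have h2 : Tendsto φ atTop (𝓝[Icc 0 1] 0) :=
      tendsto_nhdsWithin_iff.2 ⟨W.tendsto_atTop, Eventually.of_forall W.mem_Icc⟩
    have h3 := (h1 0 (by simp)).tendsto.comp h2
    simpa [H.convection_zero, Function.comp_def] using h3
  obtain ⟨a, ha⟩ := eventually_atTop.1
    (hlim.eventually_const_lt (show w ξ / 2 < 0 by linarith))
  obtain ⟨L, -, hL⟩ := H.exists_flux_gt W hV (δ := -(w ξ / 2)) (by linarith)
  obtain ⟨x, hx, hVx⟩ := hL (max a ξ)
  have h1 := ha x ((le_max_left _ _).trans hx.1)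
  have h2 := hanti ((le_max_right _ _).trans hx.1)
  simp only [hw] at h1 h2 hVx
  linarith

lemma continuousOn_phase_comp (W : IsWavefront f D g c φ) (hy : IsPhaseSolution f D g c y)
    {ξ : ℝ} (hξ : 0 < φ ξ) : ContinuousOn (fun x => y (φ x)) (Iic ξ) :=
  hy.continuousOn.comp W.continuous.continuousOn
    fun x hx => ⟨hξ.trans_le (W.antitone hx), (W.mem_Icc x).2⟩

/-- The flux of a profile is given by the phase solution. The difference `d = -V - y(φ)` solves
`d' = -(g(φ) / y(φ)) d` where `0 < φ < 1`, so it could not tend to `0` at `-∞` unless it is zero. -/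
lemma phase_comp_eq_neg_flux (H : IsReactionDiffusionData f D g) (W : IsWavefront f D g c φ)
    (hV : IsFlux f D g c φ V) (hy : IsPhaseSolution f D g c y) {ξ : ℝ} (hξ : 0 < φ ξ) :
    y (φ ξ) = -V ξ := by
  have hder : ∀ x, φ x ∈ Ioo (0 : ℝ) 1 → HasDerivAt (fun x => -V x - y (φ x))
      (-(g (φ x) / y (φ x)) * (-V x - y (φ x))) x := fun x hx => by
    have h1 := (H.hasDerivAt_flux W hV hx).fun_neg.fun_sub
      ((hy.hasDerivAt _ hx).comp x (H.hasDerivAt_profile W hV hx))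
    refine h1.congr_deriv ?_
    have := (H.diffusion_pos _ hx).ne'
    have := (hy.pos _ hx).ne'
    field_simp
    ring
  have hynn : ∀ x ≤ ξ, 0 ≤ y (φ x) := fun x hx => by
    rcases (W.mem_Icc x).2.eq_or_lt with h | h
    · rw [h, hy.terminal]
    · exact (hy.pos _ ⟨hξ.trans_le (W.antitone hx), h⟩).le
  have hc := continuousOn_phase_comp W hy hξ
  have hmem : ∀ x ≤ ξ, -V x - y (φ x) ≠ 0 → φ x ∈ Ioo (0 : ℝ) 1 := fun x hx h => by
    refine ⟨hξ.trans_le (W.antitone hx), lt_of_le_of_ne (W.mem_Icc x).2 fun h1 => h ?_⟩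
    rw [H.flux_eq_zero W hV (by simp [h1]), h1, hy.terminal]
    simp
  rcases lt_trichotomy (-V ξ - y (φ ξ)) 0 with h | h | h
  · exfalso
    have hge : ∀ x ≤ ξ, V ξ + y (φ ξ) ≤ V x + y (φ x) := by
      intro x hx
      refine le_of_deriv_nonpos_of_pos (d := fun x => V x + y (φ x)) hx
        (hV.continuous.continuousOn.add (hc.mono Icc_subset_Iic_self)) ?_ (by linarith)
      intro t ht hpos
      have htI := hmem t ht.2.le (by linarith)
      refine ⟨_, ((hder t htI).fun_neg.congr_of_eventuallyEq
        (Eventually.of_forall fun x => by simp only; ring)), ?_⟩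
      have h1 := mul_pos (div_pos (H.reaction_pos _ htI) (hy.pos _ htI)) hpos
      linarith
    have hlim : Tendsto (fun x => y (φ x)) atBot (𝓝 0) := by
      have h1 : Tendsto φ atBot (𝓝[Ioc 0 1] 1) := by
        refine tendsto_nhdsWithin_iff.2 ⟨W.tendsto_atBot, ?_⟩
        filter_upwards [eventually_le_atBot ξ] with x hx
        exact ⟨hξ.trans_le (W.antitone hx), (W.mem_Icc x).2⟩
      have h2 := (hy.continuousOn 1 (by simp)).tendsto.comp h1
      rwa [hy.terminal] at h2
    obtain ⟨x, hx1, hx2⟩ := ((hlim.eventually_lt_const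
      (show 0 < V ξ + y (φ ξ) by linarith)).and (eventually_le_atBot ξ)).exists
    linarith [hge x hx2, H.flux_nonpos W hV x]
  · linarith
  · exfalso
    have hge : ∀ x ≤ ξ, -V ξ - y (φ ξ) ≤ -V x - y (φ x) := by
      intro x hx
      refine le_of_deriv_nonpos_of_pos (d := fun x => -V x - y (φ x)) hx
        (hV.continuous.neg.continuousOn.sub (hc.mono Icc_subset_Iic_self)) ?_ h
      intro t ht hpos
      have htI := hmem t ht.2.le hpos.ne'
      refine ⟨_, hder t htI, ?_⟩
      have h1 := mul_pos (div_pos (H.reaction_pos _ htI) (hy.pos _ htI)) hpos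
      linarith
    obtain ⟨L, hL0, hL⟩ := H.exists_flux_gt W hV h
    obtain ⟨x, hx, hVx⟩ := hL (ξ - L)
    have hxξ : x ≤ ξ := by linarith [hx.2]
    linarith [hge x hxξ, hynn x hxξ]

lemma isAdmissibleSpeed_of_isWavefront (H : IsReactionDiffusionData f D g)
    (W : IsWavefront f D g c φ) : IsAdmissibleSpeed f D g c := by
  obtain ⟨V, hV⟩ := H.exists_isFlux W.travelingWave
  obtain ⟨y, hy⟩ := H.exists_isPhaseSolution c
  refine ⟨y, hy, fun s hs => ?_⟩
  obtain ⟨ξ, rfl⟩ := W.exists_eq hs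
  rw [H.phase_comp_eq_neg_flux W hV hy hs.1]
  exact H.neg_flux_le W hV ξ

lemma hasDerivAt_profile_of_phase (H : IsReactionDiffusionData f D g) (W : IsWavefront f D g c φ)
    (hy : IsPhaseSolution f D g c y) {ξ : ℝ} (hξ : φ ξ ∈ Ioo (0 : ℝ) 1) :
    HasDerivAt φ (-(y (φ ξ) / D (φ ξ))) ξ := by
  obtain ⟨V, hV⟩ := H.exists_isFlux W.travelingWave
  refine (H.hasDerivAt_profile W hV hξ).congr_deriv ?_
  rw [H.phase_comp_eq_neg_flux W hV hy hξ.1, neg_div, neg_neg]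

end IsReactionDiffusionData

/-! ### Uniqueness and construction of wavefronts -/

/-- The (reflected) travel time `T(s) = ∫_{1/2}^s D / y`: a profile with `φ(ξ₀) = 1/2` satisfies
`T(φ(ξ)) = ξ₀ - ξ` as long as `0 < φ(ξ) < 1`. -/
noncomputable def travelTime (D y : ℝ → ℝ) (s : ℝ) : ℝ := ∫ t in (1 / 2 : ℝ)..s, D t / y t

namespace IsReactionDiffusionData

variable {f D g φ V y : ℝ → ℝ} {c : ℝ}

lemma hasDerivAt_travelTime (H : IsReactionDiffusionData f D g) (hy : IsPhaseSolution f D g c y)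
    {s : ℝ} (hs : s ∈ Ioo (0 : ℝ) 1) : HasDerivAt (travelTime D y) (D s / y s) s := by
  have hcont : ContinuousOn (fun t => D t / y t) (Ioo 0 1) :=
    (H.contDiffOn_diffusion.continuousOn.mono Ioo_subset_Icc_self).div
      (hy.continuousOn.mono Ioo_subset_Ioc_self) fun t ht => (hy.pos t ht).ne'
  have hn : Ioo (0 : ℝ) 1 ∈ 𝓝 s := Ioo_mem_nhds hs.1 hs.2
  refine intervalIntegral.integral_hasDerivAt_right
    (hcont.mono (ordConnected_Ioo.uIcc_subset (by norm_num) hs)).intervalIntegrable ?_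
    (hcont.continuousAt hn)
  exact (hcont.stronglyMeasurableAtFilter_nhdsWithin measurableSet_Ioo s).filter_mono
    (by rw [nhdsWithin_eq_nhds.2 hn])

lemma strictMonoOn_travelTime (H : IsReactionDiffusionData f D g)
    (hy : IsPhaseSolution f D g c y) : StrictMonoOn (travelTime D y) (Ioo 0 1) := by
  refine strictMonoOn_of_deriv_pos (convex_Ioo 0 1)
    (fun s hs => (H.hasDerivAt_travelTime hy hs).continuousAt.continuousWithinAt) fun s hs => ?_
  rw [interior_Ioo] at hs
  rw [(H.hasDerivAt_travelTime hy hs).deriv]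
  exact div_pos (H.diffusion_pos s hs) (hy.pos s hs)

lemma exists_travelTime_eq (H : IsReactionDiffusionData f D g) (W : IsWavefront f D g c φ)
    (hy : IsPhaseSolution f D g c y) :
    ∃ ξ₀, ∀ s ∈ Ioo (0 : ℝ) 1, ∀ ξ, φ ξ = s ↔ ξ = ξ₀ - travelTime D y s := by
  have hder : ∀ ξ, φ ξ ∈ Ioo (0 : ℝ) 1 →
      HasDerivAt (fun x => travelTime D y (φ x) + x) 0 ξ := fun ξ hξ => by
    have h1 := ((H.hasDerivAt_travelTime hy hξ).comp ξ
      (H.hasDerivAt_profile_of_phase W hy hξ)).fun_add (hasDerivAt_id ξ)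
    refine h1.congr_deriv ?_
    have := (H.diffusion_pos _ hξ).ne'
    have := (hy.pos _ hξ).ne'
    field_simp
    ring
  have hconst : ∀ a b, a ≤ b → φ a ∈ Ioo (0 : ℝ) 1 → φ b ∈ Ioo (0 : ℝ) 1 →
      travelTime D y (φ b) + b = travelTime D y (φ a) + a := by
    intro a b hab ha hb
    have hmem : ∀ x ∈ Icc a b, φ x ∈ Ioo (0 : ℝ) 1 := fun x hx =>
      ⟨hb.1.trans_le (W.antitone hx.2), (W.antitone hx.1).trans_lt ha.2⟩
    exact constant_of_has_deriv_right_zero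
      (f := fun x => travelTime D y (φ x) + x)
      (fun x hx => (hder x (hmem x hx)).continuousAt.continuousWithinAt)
      (fun x hx => (hder x (hmem x (Ico_subset_Icc_self hx))).hasDerivWithinAt)
      b (right_mem_Icc.2 hab)
  obtain ⟨ξ₀, hξ₀⟩ := W.exists_eq (s := 1 / 2) (by norm_num)
  have hT : ∀ ξ, φ ξ ∈ Ioo (0 : ℝ) 1 → ξ = ξ₀ - travelTime D y (φ ξ) := by
    intro ξ hξ
    have h0 : φ ξ₀ ∈ Ioo (0 : ℝ) 1 := by rw [hξ₀]; norm_num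
    have hT0 : travelTime D y (φ ξ₀) = 0 := by rw [hξ₀]; simp [travelTime]
    rcases le_total ξ ξ₀ with h | h
    · linarith [hconst ξ ξ₀ h hξ h0]
    · linarith [hconst ξ₀ ξ h h0 hξ]
  refine ⟨ξ₀, fun s hs ξ => ⟨fun h => ?_, fun h => ?_⟩⟩
  · rw [← h] at hs ⊢
    exact hT ξ hs
  · obtain ⟨ξ', rfl⟩ := W.exists_eq hs
    rw [h, ← hT ξ' hs]

theorem wavefront_unique (H : IsReactionDiffusionData f D g) {φ₁ φ₂ : ℝ → ℝ}
    (W₁ : IsWavefront f D g c φ₁) (W₂ : IsWavefront f D g c φ₂) :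
    ∃ τ : ℝ, ∀ ξ : ℝ, φ₂ ξ = φ₁ (ξ + τ) := by
  obtain ⟨y, hy⟩ := H.exists_isPhaseSolution c
  obtain ⟨ξ₁, h₁⟩ := H.exists_travelTime_eq W₁ hy
  obtain ⟨ξ₂, h₂⟩ := H.exists_travelTime_eq W₂ hy
  have hlevel : ∀ s ∈ Ioo (0 : ℝ) 1, ∀ ξ, φ₂ ξ = s ↔ φ₁ (ξ + (ξ₁ - ξ₂)) = s := by
    intro s hs ξ
    rw [h₁ s hs, h₂ s hs]
    constructor <;> intro h <;> linarith
  obtain ⟨z, hz⟩ := W₂.exists_eq (s := 1 / 2) (by norm_num)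
  have hz' := (hlevel (1 / 2) (by norm_num) z).1 hz
  refine ⟨ξ₁ - ξ₂, fun ξ => ?_⟩
  by_cases hI₂ : φ₂ ξ ∈ Ioo (0 : ℝ) 1
  · exact ((hlevel _ hI₂ ξ).1 rfl).symm
  by_cases hI₁ : φ₁ (ξ + (ξ₁ - ξ₂)) ∈ Ioo (0 : ℝ) 1
  · exact (hlevel _ hI₁ ξ).2 rfl
  have h01 : ∀ x ∈ Icc (0 : ℝ) 1, x ∉ Ioo (0 : ℝ) 1 → x = 0 ∨ x = 1 := fun x hx h => by
    rw [mem_Ioo, not_and_or, not_lt, not_lt] at h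
    exact h.imp (fun h => le_antisymm h hx.1) fun h => le_antisymm hx.2 h
  -- both values are `0` or `1`; comparison with the point where both profiles equal `1/2`
  rcases le_total ξ z with h | h
  · have e₂ := W₂.antitone h
    have e₁ := W₁.antitone (show ξ + (ξ₁ - ξ₂) ≤ z + (ξ₁ - ξ₂) by linarith)
    rw [hz] at e₂
    rw [hz'] at e₁
    rcases h01 _ (W₂.mem_Icc ξ) hI₂ with h2 | h2 <;>
    rcases h01 _ (W₁.mem_Icc _) hI₁ with h1 | h1 <;> linarith
  · have e₂ := W₂.antitone h
    have e₁ := W₁.antitone (show z + (ξ₁ - ξ₂) ≤ ξ + (ξ₁ - ξ₂) by linarith)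
    rw [hz] at e₂
    rw [hz'] at e₁
    rcases h01 _ (W₂.mem_Icc ξ) hI₂ with h2 | h2 <;>
    rcases h01 _ (W₁.mem_Icc _) hI₁ with h1 | h1 <;> linarith

end IsReactionDiffusionData

/-- The points where a profile first reaches `0` or last equals `1`. There are at most two. -/
def arrivalPoints (φ : ℝ → ℝ) : Set ℝ :=
  {ξ | φ ξ = 0 ∧ ∀ x < ξ, 0 < φ x} ∪ {ξ | φ ξ = 1 ∧ ∀ x > ξ, φ x < 1}

lemma countable_arrivalPoints (φ : ℝ → ℝ) : (arrivalPoints φ).Countable := by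
  refine Countable.union ?_ ?_ <;> refine Set.Subsingleton.countable ?_ <;>
    rintro a ⟨ha, ha'⟩ b ⟨hb, hb'⟩ <;> by_contra hne <;> rcases lt_or_gt_of_ne hne with h | h
  · linarith [hb' a h]
  · linarith [ha' b h]
  · linarith [ha' b h]
  · linarith [hb' a h]

lemma mem_Ioo_or_eventuallyEq {φ : ℝ → ℝ} (hanti : Antitone φ) (hI : ∀ ξ, φ ξ ∈ Icc (0 : ℝ) 1)
    {ξ : ℝ} (hξ : ξ ∉ arrivalPoints φ) :
    φ ξ ∈ Ioo (0 : ℝ) 1 ∨ (φ =ᶠ[𝓝 ξ] fun _ => 0) ∨ (φ =ᶠ[𝓝 ξ] fun _ => 1) := by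
  by_cases h : φ ξ ∈ Ioo (0 : ℝ) 1
  · exact Or.inl h
  refine Or.inr ?_
  simp only [arrivalPoints, mem_union, mem_ofPred_eq, not_or, not_and, not_forall, not_lt] at hξ
  rw [mem_Ioo, not_and_or, not_lt, not_lt] at h
  rcases h with h | h
  · left
    obtain ⟨x, hx, hφ⟩ := hξ.1 (le_antisymm h (hI ξ).1)
    filter_upwards [Ioi_mem_nhds hx] with t ht
    exact le_antisymm ((hanti (le_of_lt ht)).trans hφ) (hI t).1
  · right
    obtain ⟨x, hx, hφ⟩ := hξ.2 (le_antisymm (hI ξ).2 h)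
    filter_upwards [Iio_mem_nhds hx] with t ht
    exact le_antisymm (hI t).2 (hφ.trans (hanti (le_of_lt ht)))

/-- The inverse of `s ↦ -T(s)`, extended by `1` to the left and by `0` to the right. -/
noncomputable def inverseProfile (T : ℝ → ℝ) (ξ : ℝ) : ℝ :=
  sSup (insert 0 {s | s ∈ Ioo (0 : ℝ) 1 ∧ T s ≤ -ξ})

section inverseProfile

variable {T : ℝ → ℝ}

lemma bddAbove_inverseProfile (T : ℝ → ℝ) (ξ : ℝ) :
    BddAbove (insert 0 {s | s ∈ Ioo (0 : ℝ) 1 ∧ T s ≤ -ξ}) := by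
  refine ⟨1, ?_⟩
  rintro s (rfl | hs)
  · exact zero_le_one
  · exact hs.1.2.le

lemma inverseProfile_mem_Icc (T : ℝ → ℝ) (ξ : ℝ) : inverseProfile T ξ ∈ Icc (0 : ℝ) 1 := by
  refine ⟨le_csSup (bddAbove_inverseProfile T ξ) (mem_insert _ _),
    csSup_le (insert_nonempty _ _) ?_⟩
  rintro s (rfl | hs)
  · exact zero_le_one
  · exact hs.1.2.le

lemma le_inverseProfile {s ξ : ℝ} (hs : s ∈ Ioo (0 : ℝ) 1) (h : T s ≤ -ξ) :
    s ≤ inverseProfile T ξ :=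
  le_csSup (bddAbove_inverseProfile T ξ) (Or.inr ⟨hs, h⟩)

lemma inverseProfile_le (hT : StrictMonoOn T (Ioo 0 1)) {s ξ : ℝ} (hs : s ∈ Ioo (0 : ℝ) 1)
    (h : -ξ ≤ T s) : inverseProfile T ξ ≤ s := by
  refine csSup_le (insert_nonempty _ _) ?_
  rintro t (rfl | ht)
  · exact hs.1.le
  · exact (hT.le_iff_le ht.1 hs).1 (ht.2.trans h)

lemma antitone_inverseProfile (T : ℝ → ℝ) : Antitone (inverseProfile T) := fun ξ _ h =>
  csSup_le_csSup (bddAbove_inverseProfile T ξ) (insert_nonempty _ _)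
    (insert_subset_insert fun _ hs => ⟨hs.1, hs.2.trans (neg_le_neg h)⟩)

lemma continuous_inverseProfile (hT : StrictMonoOn T (Ioo 0 1)) :
    Continuous (inverseProfile T) := by
  rw [continuous_iff_continuousAt]
  intro ξ
  refine tendsto_order.2 ⟨fun a ha => ?_, fun a ha => ?_⟩
  · rcases lt_or_ge a 0 with h0 | h0
    · exact Eventually.of_forall fun x => h0.trans_le (inverseProfile_mem_Icc T x).1
    obtain ⟨s, h1, h2⟩ := exists_between ha
    obtain ⟨s', h3, h4⟩ := exists_between h2
    have hs' : s' ∈ Ioo (0 : ℝ) 1 :=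
      ⟨by linarith, h4.trans_le (inverseProfile_mem_Icc T ξ).2⟩
    have hs : s ∈ Ioo (0 : ℝ) 1 := ⟨by linarith, h3.trans hs'.2⟩
    have h5 : T s < -ξ := by
      by_contra! h
      exact absurd (inverseProfile_le hT hs h) (not_le.2 h2)
    filter_upwards [Iio_mem_nhds (show ξ < -T s by linarith)] with x hx
    exact h1.trans_le (le_inverseProfile hs (by have := mem_Iio.1 hx; linarith))
  · rcases lt_or_ge 1 a with h1 | h1
    · exact Eventually.of_forall fun x => (inverseProfile_mem_Icc T x).2.trans_lt h1
    obtain ⟨s, h2, h3⟩ := exists_between ha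
    have hs : s ∈ Ioo (0 : ℝ) 1 :=
      ⟨(inverseProfile_mem_Icc T ξ).1.trans_lt h2, h3.trans_le h1⟩
    have h5 : -ξ < T s := by
      by_contra! h
      exact absurd (le_inverseProfile hs h) (not_le.2 h2)
    filter_upwards [Ioi_mem_nhds (show -T s < ξ by linarith)] with x hx
    exact (inverseProfile_le hT hs (by have := mem_Ioi.1 hx; linarith)).trans_lt h3

lemma tendsto_inverseProfile_atBot (T : ℝ → ℝ) :
    Tendsto (inverseProfile T) atBot (𝓝 1) := by
  refine tendsto_order.2 ⟨fun a ha => ?_, fun a ha =>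
    Eventually.of_forall fun x => (inverseProfile_mem_Icc T x).2.trans_lt ha⟩
  obtain ⟨s, h1, h2⟩ := exists_between (max_lt ha zero_lt_one)
  have hs : s ∈ Ioo (0 : ℝ) 1 := ⟨(le_max_right _ _).trans_lt h1, h2⟩
  filter_upwards [eventually_le_atBot (-T s)] with x hx
  exact ((le_max_left _ _).trans_lt h1).trans_le (le_inverseProfile hs (by linarith))

lemma tendsto_inverseProfile_atTop (hT : StrictMonoOn T (Ioo 0 1)) :
    Tendsto (inverseProfile T) atTop (𝓝 0) := by
  refine tendsto_order.2 ⟨fun a ha =>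
    Eventually.of_forall fun x => ha.trans_le (inverseProfile_mem_Icc T x).1, fun a ha => ?_⟩
  obtain ⟨s, h1, h2⟩ := exists_between (lt_min ha zero_lt_one)
  have hs : s ∈ Ioo (0 : ℝ) 1 := ⟨h1, h2.trans_le (min_le_right _ _)⟩
  filter_upwards [eventually_ge_atTop (-T s)] with x hx
  exact (inverseProfile_le hT hs (by linarith)).trans_lt (h2.trans_le (min_le_left _ _))

lemma apply_inverseProfile (hT : StrictMonoOn T (Ioo 0 1)) (hc : ContinuousOn T (Ioo 0 1)) {ξ : ℝ}
    (hξ : inverseProfile T ξ ∈ Ioo (0 : ℝ) 1) : T (inverseProfile T ξ) = -ξ := by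
  set s := inverseProfile T ξ with hs
  have hcs : ContinuousAt T s := hc.continuousAt (Ioo_mem_nhds hξ.1 hξ.2)
  rcases lt_trichotomy (T s) (-ξ) with h | h | h
  · obtain ⟨t, ⟨ht1, ht2⟩, ht3⟩ := (((hcs.eventually_lt_const h).filter_mono
      nhdsWithin_le_nhds).and (Ioo_mem_nhdsGT hξ.2)).exists.imp fun t ht =>
        (⟨⟨ht.1, ht.2.1⟩, ht.2.2⟩ : (T t < -ξ ∧ s < t) ∧ t < 1)
    exact absurd (le_inverseProfile (T := T) (ξ := ξ) ⟨hξ.1.trans ht2, ht3⟩ ht1.le) (not_le.2 ht2)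
  · exact h
  · obtain ⟨t, ⟨ht1, ht2⟩, ht3⟩ := (((hcs.eventually_const_lt h).filter_mono
      nhdsWithin_le_nhds).and (Ioo_mem_nhdsLT hξ.1)).exists.imp fun t ht =>
        (⟨⟨ht.1, ht.2.1⟩, ht.2.2⟩ : (-ξ < T t ∧ 0 < t) ∧ t < s)
    exact absurd (inverseProfile_le (T := T) (ξ := ξ) hT ⟨ht2, ht3.trans hξ.2⟩ ht1.le)
      (not_le.2 ht3)

end inverseProfile

/-- A continuous monotone function which is differentiable off a countable set is locally
absolutely continuous. -/
lemma locallyAC_of_antitone {φ : ℝ → ℝ} (hc : Continuous φ) (hanti : Antitone φ) {S : Set ℝ}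
    (hS : S.Countable) (hd : ∀ ξ ∉ S, DifferentiableAt ℝ φ ξ) : LocallyAC φ univ := by
  intro a b _
  have hint : ∀ x z, IntervalIntegrable (deriv φ) volume x z := fun x z => by
    have h1 : MonotoneOn (fun t => -φ t) (uIcc x z) := fun s _ t _ h => neg_le_neg (hanti h)
    have h2 := h1.intervalIntegrable_deriv.neg
    refine h2.congr fun t _ => ?_
    simp
  have hFTC : ∀ x, φ x = (∫ t in a..x, deriv φ t) + φ a := fun x => by
    rw [MeasureTheory.integral_eq_of_hasDerivAt_off_countable φ (deriv φ) hS hc.continuousOn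
      (fun t ht => (hd t ht.2).hasDerivAt) (hint a x)]
    ring
  have h3 := ((hint a b).absolutelyContinuousOnInterval_intervalIntegral left_mem_uIcc).add
    (((LipschitzWith.const (φ a)).lipschitzOnWith
      (s := uIcc a b)).absolutelyContinuousOnInterval)
  have h4 : φ = (fun x => ∫ t in a..x, deriv φ t) + fun _ => φ a := funext hFTC
  rw [h4]
  exact h3

namespace IsReactionDiffusionData

variable {f D g φ V y : ℝ → ℝ} {c : ℝ}

/-- Inverting the travel time of the phase solution gives a wavefront for each admissible speed. -/
theorem exists_isWavefront (H : IsReactionDiffusionData f D g) (hc : IsAdmissibleSpeed f D g c) :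
    ∃ φ, IsWavefront f D g c φ := by
  obtain ⟨y, hy, hle⟩ := hc
  set T := travelTime D y
  have hT : StrictMonoOn T (Ioo 0 1) := H.strictMonoOn_travelTime hy
  have hTc : ContinuousOn T (Ioo 0 1) := fun s hs =>
    (H.hasDerivAt_travelTime hy hs).continuousAt.continuousWithinAt
  set φ := inverseProfile T with hφ
  have hcont : Continuous φ := continuous_inverseProfile hT
  have hanti : Antitone φ := antitone_inverseProfile T
  have hI : ∀ ξ, φ ξ ∈ Icc (0 : ℝ) 1 := inverseProfile_mem_Icc T
  have hder : ∀ ξ, φ ξ ∈ Ioo (0 : ℝ) 1 → HasDerivAt φ (-(y (φ ξ) / D (φ ξ))) ξ := by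
    intro ξ hξ
    have h1 := (H.hasDerivAt_travelTime hy hξ).fun_neg
    have hne := div_pos (H.diffusion_pos _ hξ) (hy.pos _ hξ)
    refine (h1.of_local_left_inverse hcont.continuousAt (neg_ne_zero.2 hne.ne') ?_).congr_deriv ?_
    · filter_upwards [(isOpen_Ioo.preimage hcont).mem_nhds hξ] with x hx
      change -T (inverseProfile T x) = x
      rw [apply_inverseProfile hT hTc hx, neg_neg]
    · rw [inv_neg, inv_div]
  -- the phase solution, made to vanish at `0`
  set Y := Function.update y 0 0 with hY
  have hYy : ∀ s, 0 < s → Y s = y s := fun s hs => Function.update_of_ne hs.ne' _ _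
  have hYc : ContinuousOn Y (Icc 0 1) := by
    intro s hs
    rcases hs.1.eq_or_lt with rfl | h0
    · have h1 : Tendsto Y (𝓝[>] 0) (𝓝 (Y 0)) := by
        simp only [hY, Function.update_self]
        refine (H.tendsto_zero_of_le hy hle).congr' ?_
        filter_upwards [self_mem_nhdsWithin] with s hs using (hYy s hs).symm
      have h2 : ContinuousWithinAt Y (insert 0 (Ioi 0)) 0 := continuousWithinAt_insert_self.2 h1
      refine h2.mono fun x hx => ?_
      rcases hx.1.eq_or_lt with h | h
      · exact Or.inl h.symm
      · exact Or.inr h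
    · have h1 : ContinuousWithinAt y (Icc 0 1) s := by
        refine (hy.continuousOn s ⟨h0, hs.2⟩).mono_of_mem_nhdsWithin ?_
        filter_upwards [self_mem_nhdsWithin, mem_nhdsWithin_of_mem_nhds (Ioi_mem_nhds h0)]
          with x hx hx0 using ⟨hx0, hx.2⟩
      refine h1.congr_of_eventuallyEq ?_ (hYy s h0)
      filter_upwards [mem_nhdsWithin_of_mem_nhds (Ioi_mem_nhds h0)] with x hx using hYy x hx
  have hY1 : Y 1 = 0 := by rw [hYy 1 one_pos, hy.terminal]
  have hY0 : Y 0 = 0 := by simp [hY]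
  have hcases := fun ξ (hξ : ξ ∉ arrivalPoints φ) => mem_Ioo_or_eventuallyEq hanti hI hξ
  have hcount := countable_arrivalPoints φ
  have hae : ∀ᵐ ξ : ℝ, ξ ∉ arrivalPoints φ :=
    (compl_mem_ae_iff).2 (hcount.measure_zero volume)
  have hdiff : ∀ ξ ∉ arrivalPoints φ, DifferentiableAt ℝ φ ξ := by
    intro ξ hξ
    rcases hcases ξ hξ with h | h | h
    · exact (hder ξ h).differentiableAt
    · exact h.differentiableAt_iff.2 (differentiableAt_const _)
    · exact h.differentiableAt_iff.2 (differentiableAt_const _)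
  have hVc : Continuous fun ξ => -Y (φ ξ) := (hYc.comp_continuous hcont hI).neg
  have hgφ : Continuous fun ξ => g (φ ξ) := H.continuousOn_reaction.comp_continuous hcont hI
  have hfφ : Continuous fun ξ => f (φ ξ) :=
    H.contDiffOn_convection.continuousOn.comp_continuous hcont hI
  set w : ℝ → ℝ := fun ξ => -Y (φ ξ) - f (φ ξ) + c * φ ξ with hw
  have hwc : Continuous w := (hVc.sub hfφ).add (continuous_const.mul hcont)
  have hwd : ∀ ξ ∉ arrivalPoints φ, HasDerivAt w (-g (φ ξ)) ξ := by
    intro ξ hξ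
    have hconst : ∀ r : ℝ, (φ =ᶠ[𝓝 ξ] fun _ => r) → g r = 0 → HasDerivAt w (-g (φ ξ)) ξ := by
      intro r hr hgr
      rw [hr.eq_of_nhds, hgr, neg_zero]
      refine (hasDerivAt_const ξ (-Y r - f r + c * r)).congr_of_eventuallyEq ?_
      filter_upwards [hr] with x hx
      simp only [hw, hx]
    rcases hcases ξ hξ with h | h | h
    · have h1 := ((hy.hasDerivAt _ h).comp ξ (hder ξ h)).fun_neg.fun_add
        ((H.hasDerivAt_linear_sub c h).comp ξ (hder ξ h))
      refine (h1.congr_of_eventuallyEq ?_).congr_deriv ?_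
      · filter_upwards [(isOpen_Ioo.preimage hcont).mem_nhds h] with x hx
        simp only [hw, Function.comp, hYy _ hx.1]
        ring
      · have := (H.diffusion_pos _ h).ne'
        have := (hy.pos _ h).ne'
        field_simp
        ring
    · exact hconst 0 h H.reaction_zero
    · exact hconst 1 h H.reaction_one
  have hflux : IsFlux f D g c φ fun ξ => -Y (φ ξ) := by
    refine ⟨hVc, ?_, fun ξ => ?_⟩
    · filter_upwards [hae] with ξ hξ
      rcases hcases ξ hξ with h | h | h
      · rw [(hder ξ h).deriv, hYy _ h.1]
        have := (H.diffusion_pos _ h).ne'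
        field_simp
      · rw [h.eq_of_nhds, H.diffusion_zero, hY0]
        simp
      · rw [h.eq_of_nhds, h.deriv_eq, deriv_const, hY1]
        simp
    · have h1 : ∀ x, w x = (∫ t in (0 : ℝ)..x, -g (φ t)) + w 0 := fun x => by
        rw [MeasureTheory.integral_eq_of_hasDerivAt_off_countable w _ hcount hwc.continuousOn
          (fun t ht => hwd t ht.2) (hgφ.neg.intervalIntegrable _ _)]
        ring
      have h2 := ((hgφ.neg.integral_hasStrictDerivAt 0 ξ).hasDerivAt).add_const (w 0)
      exact h2.congr_of_eventuallyEq (Eventually.of_forall h1)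
  have hbot : Tendsto φ atBot (𝓝 1) := tendsto_inverseProfile_atBot T
  have htop : Tendsto φ atTop (𝓝 0) := tendsto_inverseProfile_atTop hT
  refine ⟨φ, ⟨H.isTravelingWave_of_isFlux hcont hI (locallyAC_of_antitone hcont hanti hcount hdiff)
    (hae.mono hdiff) hflux, Or.inr hanti, ?_, hbot, htop⟩⟩
  obtain ⟨a, ha⟩ := (hbot.eventually_const_lt (show (1 / 2 : ℝ) < 1 by norm_num)).exists
  obtain ⟨b, hb⟩ := (htop.eventually_lt_const (show (0 : ℝ) < 1 / 2 by norm_num)).exists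
  exact ⟨a, b, (hb.trans ha).ne'⟩

end IsReactionDiffusionData

/-! ### Classical and sharp profiles -/

lemma AbsolutelyContinuousOnInterval.of_dist_le {u v : ℝ → ℝ} {a b K : ℝ} (hK : 0 < K)
    (hu : AbsolutelyContinuousOnInterval u a b)
    (h : ∀ x ∈ uIcc a b, ∀ z ∈ uIcc a b, dist (v x) (v z) ≤ K * dist (u x) (u z)) :
    AbsolutelyContinuousOnInterval v a b := by
  rw [absolutelyContinuousOnInterval_iff] at hu ⊢
  intro ε hε
  obtain ⟨δ, hδ, hδ'⟩ := hu (ε / K) (by positivity)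
  refine ⟨δ, hδ, fun E hE hlt => ?_⟩
  have h1 := hδ' E hE hlt
  rw [lt_div_iff₀' hK, Finset.mul_sum] at h1
  refine lt_of_le_of_lt (Finset.sum_le_sum fun i hi => ?_) h1
  exact h _ (hE.1 i hi).1 _ (hE.1 i hi).2

lemma AbsolutelyContinuousOnInterval.congr_of_eqOn {u v : ℝ → ℝ} {a b : ℝ}
    (hu : AbsolutelyContinuousOnInterval u a b) (h : EqOn v u (uIcc a b)) :
    AbsolutelyContinuousOnInterval v a b :=
  hu.of_dist_le one_pos fun x hx z hz => by rw [h hx, h hz, one_mul]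

lemma AbsolutelyContinuousOnInterval.comp_contDiffOn {φ u : ℝ → ℝ} {a b : ℝ}
    (hu : ContDiffOn ℝ 1 u (Icc 0 1)) (hI : ∀ ξ, φ ξ ∈ Icc (0 : ℝ) 1)
    (hφ : AbsolutelyContinuousOnInterval φ a b) :
    AbsolutelyContinuousOnInterval (fun ξ => u (φ ξ)) a b := by
  obtain ⟨K, hK⟩ := hu.exists_lipschitzOnWith one_ne_zero (convex_Icc _ _) isCompact_Icc
  refine hφ.of_dist_le (K := K + 1) (by positivity) fun x _ z _ => ?_
  exact (hK.dist_le_mul _ (hI x) _ (hI z)).trans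
    (mul_le_mul_of_nonneg_right (by linarith) dist_nonneg)

namespace IsReactionDiffusionData

variable {f D g φ V y : ℝ → ℝ} {c : ℝ}

lemma locallyAC_flux (H : IsReactionDiffusionData f D g) (W : IsWavefront f D g c φ)
    (hV : IsFlux f D g c φ V) (a b : ℝ) : AbsolutelyContinuousOnInterval V a b := by
  have hφ := W.travelingWave.locallyAC a b (subset_univ _)
  have hw : AbsolutelyContinuousOnInterval (fun ξ => V ξ - f (φ ξ) + c * φ ξ) a b := by
    refine ContDiffOn.absolutelyContinuousOnInterval (ContDiff.contDiffOn ?_)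
    rw [contDiff_one_iff_deriv]
    refine ⟨fun ξ => (hV.hasDerivAt ξ).differentiableAt, ?_⟩
    rw [funext fun ξ => (hV.hasDerivAt ξ).deriv]
    exact (W.continuous_comp H.continuousOn_reaction).neg
  have h1 := (hw.add (hφ.comp_contDiffOn H.contDiffOn_convection W.mem_Icc)).sub (hφ.const_mul c)
  refine h1.congr_of_eqOn fun ξ _ => ?_
  simp only [Pi.add_apply, Pi.sub_apply]
  ring

/-- Away from the value `1`, a profile is classical on every open set where it is differentiable. -/
lemma isClassicalOn (H : IsReactionDiffusionData f D g) (W : IsWavefront f D g c φ) {J : Set ℝ}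
    (hJ : IsOpen J) (hJ1 : ∀ ξ ∈ J, φ ξ ≠ 1) (hd : ∀ ξ ∈ J, DifferentiableAt ℝ φ ξ) :
    IsClassicalOn f D g c φ J := by
  obtain ⟨V, hV⟩ := H.exists_isFlux W.travelingWave
  have hI : ∀ ξ ∈ J, φ ξ = 0 ∨ φ ξ ∈ Ioo (0 : ℝ) 1 := fun ξ hξ => by
    have h1 := W.mem_Icc ξ
    rcases h1.1.eq_or_lt with h | h
    · exact Or.inl h.symm
    · exact Or.inr ⟨h, lt_of_le_of_ne h1.2 (hJ1 ξ hξ)⟩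
  have hEq : EqOn (fun ξ => D (φ ξ) * deriv φ ξ) V J := fun ξ hξ => by
    rcases hI ξ hξ with h | h
    · rw [H.flux_eq_zero W hV (by simp [h])]
      simp [h, H.diffusion_zero]
    · have := (H.diffusion_pos _ h).ne'
      simp only [(H.hasDerivAt_profile W hV h).deriv]
      field_simp
  refine ⟨hd, fun a b hab => (H.locallyAC_flux W hV a b).congr_of_eqOn (hEq.mono hab), ?_⟩
  rw [ae_restrict_iff' hJ.measurableSet]
  have hae : ∀ᵐ ξ : ℝ, ξ ∉ arrivalPoints φ :=
    (compl_mem_ae_iff).2 ((countable_arrivalPoints φ).measure_zero volume)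
  filter_upwards [hae] with ξ hξ hξJ
  have hEq' : (fun ξ => D (φ ξ) * deriv φ ξ) =ᶠ[𝓝 ξ] V := by
    filter_upwards [hJ.mem_nhds hξJ] with x hx using hEq hx
  rw [hEq'.deriv_eq]
  rcases mem_Ioo_or_eventuallyEq W.antitone W.mem_Icc hξ with h | h | h
  · rw [(H.hasDerivAt_flux W hV h).deriv, (H.hasDerivAt_profile W hV h).deriv]
    ring
  · have hV0 : V =ᶠ[𝓝 ξ] fun _ => 0 := by
      filter_upwards [h] with x hx
      exact H.flux_eq_zero W hV (by simp [hx])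
    rw [hV0.deriv_eq, h.deriv_eq, h.eq_of_nhds, H.reaction_zero]
    simp
  · exact absurd h.eq_of_nhds (hJ1 ξ hξJ)

lemma eventually_mem_Ioo_of_arrival (W : IsWavefront f D g c φ) {ξ₀ : ℝ} (h0 : φ ξ₀ = 0)
    (hpos : ∀ x < ξ₀, 0 < φ x) : ∀ᶠ x in 𝓝[<] ξ₀, φ x ∈ Ioo (0 : ℝ) 1 := by
  have h1 : ∀ᶠ x in 𝓝 ξ₀, φ x < 1 :=
    W.continuous.continuousAt.eventually_lt_const (by rw [h0]; exact one_pos)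
  filter_upwards [nhdsWithin_le_nhds h1, self_mem_nhdsWithin] with x hx hx'
  exact ⟨hpos x hx', hx⟩

lemma tendsto_nhdsGT_of_arrival (W : IsWavefront f D g c φ) {ξ₀ : ℝ} (h0 : φ ξ₀ = 0)
    (hpos : ∀ x < ξ₀, 0 < φ x) : Tendsto φ (𝓝[<] ξ₀) (𝓝[>] 0) := by
  refine tendsto_nhdsWithin_iff.2 ⟨?_, ?_⟩
  · have := W.continuous.tendsto ξ₀
    rw [h0] at this
    exact this.mono_left nhdsWithin_le_nhds
  · filter_upwards [self_mem_nhdsWithin] with x hx using hpos x hx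

/-- Near an arrival point at `0` the derivative of the profile is read off from `y / D`. -/
lemma tendsto_deriv_of_arrival (H : IsReactionDiffusionData f D g) (W : IsWavefront f D g c φ)
    (hy : IsPhaseSolution f D g c y) {ξ₀ : ℝ} (h0 : φ ξ₀ = 0) (hpos : ∀ x < ξ₀, 0 < φ x)
    {l : Filter ℝ} (hl : Tendsto (fun s => -(y s / D s)) (𝓝[>] 0) l) :
    Tendsto (deriv φ) (𝓝[<] ξ₀) l := by
  refine (hl.comp (tendsto_nhdsGT_of_arrival W h0 hpos)).congr' ?_
  filter_upwards [eventually_mem_Ioo_of_arrival W h0 hpos] with x hx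
  exact (H.hasDerivAt_profile_of_phase W hy hx).deriv.symm

lemma isClassicalAt_zero (H : IsReactionDiffusionData f D g) {c' : ℝ}
    (hc' : IsAdmissibleSpeed f D g c') (hlt : c' < c) (W : IsWavefront f D g c φ) :
    IsClassicalAt f D g univ c φ 0 := by
  obtain ⟨y, hy⟩ := H.exists_isPhaseSolution c
  have hset : {ξ ∈ univ | φ ξ ≠ 1 - 0} = {ξ | φ ξ ≠ 1} := by ext; simp
  rw [IsClassicalAt, hset]
  refine H.isClassicalOn W (isOpen_ne_fun W.continuous continuous_const) (fun _ h => h) ?_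
  intro ξ hξ
  by_cases harr : ξ ∈ arrivalPoints φ
  · rcases harr with ⟨h0, hpos⟩ | ⟨h1, -⟩
    · have hlim : Tendsto (deriv φ) (𝓝[<] ξ) (𝓝 0) :=
        H.tendsto_deriv_of_arrival W hy h0 hpos
          (by simpa using (H.tendsto_phaseSolution_div_diffusion hc' hlt hy).neg)
      have hleft : HasDerivWithinAt φ 0 (Iic ξ) ξ :=
        hasDerivWithinAt_Iic_of_tendsto_deriv (s := {x | φ x ∈ Ioo (0 : ℝ) 1})
          (fun x hx => (H.hasDerivAt_profile_of_phase W hy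
            hx).differentiableAt.differentiableWithinAt)
          W.continuous.continuousWithinAt (eventually_mem_Ioo_of_arrival W h0 hpos) hlim
      have hright : HasDerivWithinAt φ 0 (Ici ξ) ξ :=
        (hasDerivWithinAt_const ξ (Ici ξ) (0 : ℝ)).congr
          (fun x hx => le_antisymm ((W.antitone hx).trans h0.le) (W.mem_Icc x).1) h0
      have := hleft.union hright
      rw [Iic_union_Ici, hasDerivWithinAt_univ] at this
      exact this.differentiableAt
    · exact absurd h1 hξ
  · rcases mem_Ioo_or_eventuallyEq W.antitone W.mem_Icc harr with h | h | h
    · exact (H.hasDerivAt_profile_of_phase W hy h).differentiableAt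
    · exact h.differentiableAt_iff.2 (differentiableAt_const _)
    · exact absurd h.eq_of_nhds hξ

/-- If `y` has positive slope at `0`, then `D ≤ M y` near `0`, so `φ' = -y(φ) / D(φ)` stays away
from zero. -/
lemma exists_phase_div_diffusion_ge (H : IsReactionDiffusionData f D g)
    (hy : IsPhaseSolution f D g c y) {k : ℝ} (hk : 0 < k)
    (hlim : Tendsto (fun s => y s / s) (𝓝[>] 0) (𝓝 k)) :
    ∃ m > 0, ∃ δ ∈ Ioo (0 : ℝ) 1, ∀ s ∈ Ioc 0 δ, -(y s / D s) ≤ -m := by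
  have hD := tendsto_div_self_of_contDiffOn_Icc H.contDiffOn_diffusion H.diffusion_zero
  set B := |derivWithin D (Icc 0 1) 0| + 1 with hB
  have h1 : ∀ᶠ s in 𝓝[>] (0 : ℝ), D s / s < B :=
    hD.eventually_lt_const (by linarith [le_abs_self (derivWithin D (Icc 0 1) 0)])
  have h2 : ∀ᶠ s in 𝓝[>] (0 : ℝ), k / 2 < y s / s := hlim.eventually_const_lt (by linarith)
  obtain ⟨δ, hδ, h⟩ := eventually_nhdsGT_zero_iff.1 (h1.and h2)
  refine ⟨k / 2 / B, by positivity, δ, hδ, fun s hs => ?_⟩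
  obtain ⟨h3, h4⟩ := h s hs
  have hDs := H.diffusion_pos s ⟨hs.1, hs.2.trans_lt hδ.2⟩
  rw [neg_le_neg_iff]
  calc k / 2 / B ≤ (y s / s) / (D s / s) := by
        have := hs.1
        have := hy.pos s ⟨hs.1, hs.2.trans_lt hδ.2⟩
        gcongr
    _ = y s / D s := by
        have := hs.1.ne'
        field_simp

lemma isSharpAt_zero (H : IsReactionDiffusionData f D g) (W : IsWavefront f D g c φ)
    (hy : IsPhaseSolution f D g c y) {k : ℝ} (hk : 0 < k)
    (hlim : Tendsto (fun s => y s / s) (𝓝[>] 0) (𝓝 k)) : IsSharpAt f D g univ c φ 0 := by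
  obtain ⟨m, hm, δ, hδ, hsteep⟩ := H.exists_phase_div_diffusion_ge hy hk hlim
  have hder : ∀ x, 0 < φ x → φ x ≤ δ → ∃ d, HasDerivAt φ d x ∧ d ≤ -m := fun x h1 h2 =>
    ⟨_, H.hasDerivAt_profile_of_phase W hy ⟨h1, h2.trans_lt hδ.2⟩, hsteep _ ⟨h1, h2⟩⟩
  -- the profile reaches `0`
  have hex : ∃ x, φ x = 0 := by
    obtain ⟨a, ha⟩ := (W.tendsto_atTop.eventually_lt_const hδ.1).exists
    obtain ⟨x, hx, hn⟩ := exists_mem_Icc_not_deriv_le W.mem_Icc hm a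
    refine ⟨x, le_antisymm ?_ (W.mem_Icc x).1⟩
    by_contra! h
    exact hn (hder x h ((W.antitone hx.1).trans ha.le))
  have hbdd : BddBelow {x | φ x = 0} := by
    obtain ⟨b, hb⟩ := (W.tendsto_atBot.eventually_const_lt (zero_lt_one' ℝ)).exists
    refine ⟨b, fun x hx => ?_⟩
    by_contra! h
    have := W.antitone h.le
    rw [show φ x = 0 from hx] at this
    linarith
  have hcl : IsClosed {x | φ x = 0} := isClosed_eq W.continuous continuous_const
  have h0 : φ (sInf {x | φ x = 0}) = 0 := hcl.csInf_mem hex hbdd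
  set ξ₀ := sInf {x | φ x = 0} with hξ₀
  have hpos : ∀ x < ξ₀, 0 < φ x := fun x hx =>
    lt_of_le_of_ne (W.mem_Icc x).1 fun h => absurd (csInf_le hbdd h.symm) (not_le.2 hx)
  refine ⟨ξ₀, mem_univ _, h0, fun hd => ?_, ?_⟩
  · have hmin : IsLocalMin φ ξ₀ := Eventually.of_forall fun x => by
      rw [h0]; exact (W.mem_Icc x).1
    have hd0 := hd.hasDerivAt
    rw [hmin.deriv_eq_zero, hasDerivAt_iff_tendsto_slope] at hd0
    have hslope : Tendsto (slope φ ξ₀) (𝓝[<] ξ₀) (𝓝 0) :=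
      hd0.mono_left (nhdsWithin_mono ξ₀ fun x hx => (mem_Iio.1 hx).ne)
    have hle : ∀ᶠ x in 𝓝[<] ξ₀, slope φ ξ₀ x ≤ -m := by
      have h1 : ∀ᶠ x in 𝓝 ξ₀, φ x < δ :=
        W.continuous.continuousAt.eventually_lt_const (by rw [h0]; exact hδ.1)
      filter_upwards [nhdsWithin_le_nhds h1, self_mem_nhdsWithin] with x hx hxξ
      have hxξ' : x < ξ₀ := hxξ
      have hder' : ∀ t ∈ interior (Icc x ξ₀), ∃ d, HasDerivAt φ d t ∧ d ≤ -m := fun t ht => by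
        rw [interior_Icc] at ht
        exact hder t (hpos t ht.2) ((W.antitone ht.1.le).trans hx.le)
      have h2 := (convex_Icc x ξ₀).image_sub_le_mul_sub_of_deriv_le (f := φ) (C := -m)
        W.continuous.continuousOn
        (fun t ht => by
          obtain ⟨d, h1, -⟩ := hder' t ht
          exact h1.differentiableAt.differentiableWithinAt)
        (fun t ht => by
          obtain ⟨d, h1, h2⟩ := hder' t ht
          rwa [h1.deriv])
        x (left_mem_Icc.2 hxξ'.le) ξ₀ (right_mem_Icc.2 hxξ'.le) hxξ'.le
      rw [slope_comm, slope_def_field, div_le_iff₀ (sub_pos.2 hxξ')]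
      exact h2
    have := le_of_tendsto hslope hle
    linarith
  · have hset : {ξ ∈ univ | φ ξ ≠ 1 - 0} \ {ξ₀} = {ξ | φ ξ ≠ 1} ∩ {ξ₀}ᶜ := by ext; simp
    rw [hset]
    refine H.isClassicalOn W ((isOpen_ne_fun W.continuous continuous_const).inter
      isOpen_compl_singleton) (fun _ h => h.1) ?_
    rintro ξ ⟨hξ1, hξξ₀⟩
    rcases lt_or_gt_of_ne (show ξ ≠ ξ₀ from hξξ₀) with h | h
    · exact (H.hasDerivAt_profile_of_phase W hy
        ⟨hpos ξ h, lt_of_le_of_ne (W.mem_Icc ξ).2 hξ1⟩).differentiableAt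
    · have : φ =ᶠ[𝓝 ξ] fun _ => 0 := by
        filter_upwards [Ioi_mem_nhds h] with x hx
        exact le_antisymm ((W.antitone (le_of_lt hx)).trans h0.le) (W.mem_Icc x).1
      exact this.differentiableAt_iff.2 (differentiableAt_const _)

lemma tendsto_phase_div_diffusion_of_pos (H : IsReactionDiffusionData f D g) {k : ℝ}
    (hlim : Tendsto (fun s => y s / s) (𝓝[>] 0) (𝓝 k)) (hD0 : 0 < derivWithin D (Icc 0 1) 0) :
    Tendsto (fun s => y s / D s) (𝓝[>] 0) (𝓝 (k / derivWithin D (Icc 0 1) 0)) := by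
  have hD := tendsto_div_self_of_contDiffOn_Icc H.contDiffOn_diffusion H.diffusion_zero
  refine (hlim.div hD hD0.ne').congr' ?_
  filter_upwards [self_mem_nhdsWithin] with s hs
  exact div_div_div_cancel_right₀ (ne_of_gt hs) _ _

lemma tendsto_phase_div_diffusion_of_eq_zero (H : IsReactionDiffusionData f D g)
    (hy : IsPhaseSolution f D g c y) {k : ℝ} (hk : 0 < k)
    (hlim : Tendsto (fun s => y s / s) (𝓝[>] 0) (𝓝 k)) (hD0 : derivWithin D (Icc 0 1) 0 = 0) :
    Tendsto (fun s => y s / D s) (𝓝[>] 0) atTop := by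
  have hD := tendsto_div_self_of_contDiffOn_Icc H.contDiffOn_diffusion H.diffusion_zero
  rw [hD0] at hD
  have h1 : Tendsto (fun s => D s / y s) (𝓝[>] 0) (𝓝 0) := by
    have h2 := hD.div hlim hk.ne'
    rw [zero_div] at h2
    refine h2.congr' ?_
    filter_upwards [self_mem_nhdsWithin] with s hs
    exact div_div_div_cancel_right₀ (ne_of_gt hs) _ _
  have h3 : Tendsto (fun s => D s / y s) (𝓝[>] 0) (𝓝[>] 0) := by
    refine tendsto_nhdsWithin_iff.2 ⟨h1, ?_⟩
    filter_upwards [Ioo_mem_nhdsGT zero_lt_one] with s hs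
    exact div_pos (H.diffusion_pos s hs) (hy.pos s hs)
  exact h3.inv_tendsto_nhdsGT_zero.congr fun s => inv_div _ _

end IsReactionDiffusionData

theorem mainTheorem2 (f D g : ℝ → ℝ)
    (hf : ContDiffOn ℝ 1 f (Icc 0 1)) (hf0 : f 0 = 0)
    (hD : ContDiffOn ℝ 1 D (Icc 0 1)) (hDpos : ∀ s ∈ Ioo (0 : ℝ) 1, 0 < D s) (hD0 : D 0 = 0)
    (hg : ContinuousOn g (Icc 0 1)) (hgpos : ∀ s ∈ Ioo (0 : ℝ) 1, 0 < g s)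
    (hg0 : g 0 = 0) (hg1 : g 1 = 0)
    (hDg : limsup (fun s : ℝ => ((D s * g s / s : ℝ) : EReal)) (𝓝[>] 0) < ⊤) :
    ∃ cStar : ℝ,
      supConvection f ≤ cStar ∧
      cStar ≤ supConvection f + 2 * Real.sqrt (supMeanReaction D g) ∧
      (∀ c : ℝ, (∃ φ : ℝ → ℝ, IsWavefront f D g c φ) ↔ cStar ≤ c) ∧
      (∀ (c : ℝ) (φ₁ φ₂ : ℝ → ℝ), IsWavefront f D g c φ₁ → IsWavefront f D g c φ₂ →
        ∃ τ : ℝ, ∀ ξ : ℝ, φ₂ ξ = φ₁ (ξ + τ)) ∧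
      (∀ (c : ℝ) (φ : ℝ → ℝ), IsWavefront f D g c φ →
        (∀ ξ : ℝ, 0 < φ ξ → φ ξ < 1 → deriv φ ξ < 0) ∧
        (cStar < c → IsClassicalAt f D g univ c φ 0) ∧
        (c = cStar → derivWithin f (Icc 0 1) 0 < cStar →
          IsSharpAt f D g univ c φ 0 ∧
          ∀ ξ₀ : ℝ, φ ξ₀ = 0 → (∀ ξ < ξ₀, 0 < φ ξ) →
            (0 < derivWithin D (Icc 0 1) 0 →
              (derivWithin f (Icc 0 1) 0 - cStar) / derivWithin D (Icc 0 1) 0 < 0 ∧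
              Tendsto (deriv φ) (𝓝[<] ξ₀)
                (𝓝 ((derivWithin f (Icc 0 1) 0 - cStar) / derivWithin D (Icc 0 1) 0))) ∧
            (derivWithin D (Icc 0 1) 0 = 0 → Tendsto (deriv φ) (𝓝[<] ξ₀) atBot))) := by
  have H : IsReactionDiffusionData f D g := ⟨hf, hf0, hD, hDpos, hD0, hg, hgpos, hg0, hg1⟩
  obtain ⟨cStar, hlow, hupp, hStar⟩ := H.exists_criticalSpeed
  refine ⟨cStar, hlow, hupp, fun c => ⟨?_, fun hc => ?_⟩, fun c φ₁ φ₂ W₁ W₂ =>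
    H.wavefront_unique W₁ W₂, fun c φ W => ⟨fun ξ h0 h1 => ?_, fun hc => ?_, ?_⟩⟩
  · rintro ⟨φ, W⟩
    exact (hStar c).1 (H.isAdmissibleSpeed_of_isWavefront W)
  · exact H.exists_isWavefront ((hStar c).2 hc)
  · obtain ⟨y, hy⟩ := H.exists_isPhaseSolution c
    have hξ : φ ξ ∈ Ioo (0 : ℝ) 1 := ⟨h0, h1⟩
    rw [(H.hasDerivAt_profile_of_phase W hy hξ).deriv]
    exact neg_neg_of_pos (div_pos (hy.pos _ hξ) (H.diffusion_pos _ hξ))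
  · exact H.isClassicalAt_zero ((hStar cStar).2 le_rfl) hc W
  · rintro rfl hlt
    obtain ⟨y, hy⟩ := H.exists_isPhaseSolution c
    have hk : 0 < c - derivWithin f (Icc 0 1) 0 := sub_pos.2 hlt
    have hlim := H.tendsto_phaseSolution_div_critical hStar hlt hy
    refine ⟨H.isSharpAt_zero W hy hk hlim, fun ξ₀ h0 hpos => ⟨fun hD' => ⟨?_, ?_⟩, fun hD' => ?_⟩⟩
    · exact div_neg_of_neg_of_pos (sub_neg.2 hlt) hD'
    · refine H.tendsto_deriv_of_arrival W hy h0 hpos ?_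
      have := (H.tendsto_phase_div_diffusion_of_pos hlim hD').neg
      rwa [← neg_div, neg_sub] at this
    · refine H.tendsto_deriv_of_arrival W hy h0 hpos ?_
      exact tendsto_neg_atTop_atBot.comp
        (H.tendsto_phase_div_diffusion_of_eq_zero hy hk hlim hD')
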